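/- For $n\ge 1$ let $\mathsf K_n$ be the braid matroid, i.e. the graphic matroid of the complete graph on $n$ vertices, and let $\mathcal L(\mathsf K_n)$ be its lattice of flats. Let $\mathcal G_{\min}$ be the minimal building set of $\mathsf K_n$, i.e. the set of all nonempty flats $F$ such that $\mathsf K_n|_F$ is connected (its lattice of flats is not a nontrivial Cartesian product). Let $$D(\mathsf K_n,\mathcal G_{\min})=\mathbb Q[x_G : G\in\mathcal G_{\min}]/I$$ be the Chow ring, graded with all $x_G$ in degree $1$, where $I$ is generated by the elements $$\Big(\prod_{A\in S}x_A\Big)\Big(\sum_{H\in\mathcal G_{\min},\,H\supseteq G}x_H\Big)^{\operatorname{rk}(G)-\operatorname{rk}(\sup(S,G))}\qquad (S\subseteq\mathcal G_{\min},\ G\in\mathcal G_{\min}),$$ $\sup(S,G)$ being the join in $\mathcal L(\mathsf K_n)$ of all $A\in S$ with $A\subsetneq G$. Let $$H_{\mathsf K_n}(x)=\sum_{i\ge 0}\dim_{\mathbb Q}D^i(\mathsf K_n,\mathcal G_{\min})\,x^i$$ be its Hilbert series. Then $H_{\mathsf K_n}(x)$ is a polynomial for every $n\ge 1$, one has $H_{\mathsf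 K_1}(x)=H_{\mathsf K_2}(x)=1$, and for all $n\ge 3$ both of the following recursions hold: $$H_{\mathsf K_n}(x)=H_{\mathsf K_{n-1}}(x)+x\sum_{j=2}^{n-1}\binom{n-1}{j}H_{\mathsf K_j}(x)\,H_{\mathsf K_{n-j}}(x),$$ $$H_{\mathsf K_n}(x)=(1+x)\,H_{\mathsf K_{n-1}}(x)+\frac x2\sum_{j=2}^{n-2}\binom nj H_{\mathsf K_j}(x)\,H_{\mathsf K_{n-j}}(x).$$ Moreover, either one of the two recursions, together with the initial values, determines the sequence: if $(P_n)_{n\ge 1}$ is a sequence in $\mathbb Q[[x]]$ with $P_1=P_2=1$ that satisfies the first recursion for all $n\ge 3$, or that satisfies the second recursion for all $n\ge 3$, then $P_n=H_{\mathsf K_n}$ for all $n\ge 1$. -/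

import Mathlib

universe u

/-- `I` is a set of edges of `G` that contains no cycle. -/
def IsForestIn {V : Type u} (G : SimpleGraph V) (I : Set (Sym2 V)) : Prop :=
  I ⊆ G.edgeSet ∧ (SimpleGraph.fromEdgeSet I).IsAcyclic

theorem IsForestIn.exists_insert {V : Type u} {G : SimpleGraph V} {I B : Set (Sym2 V)}
    (hI : IsForestIn G I) (hImax : ¬ Maximal (IsForestIn G) I)
    (hB : Maximal (IsForestIn G) B) : ∃ e ∈ B \ I, IsForestIn G (insert e I) := by
  by_contra hcon
  push Not at hcon
  have hIG : SimpleGraph.fromEdgeSet I ≤ G := by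
    rw [SimpleGraph.fromEdgeSet_le]; exact fun e he => hI.1 he.1
  have hBG : SimpleGraph.fromEdgeSet B ≤ G := by
    rw [SimpleGraph.fromEdgeSet_le]; exact fun e he => hB.prop.1 he.1
  have key : ∀ K : Set (Sym2 V), IsForestIn G K → (Maximal (IsForestIn G) K ↔
      Maximal (fun F ↦ F ≤ G ∧ F.IsAcyclic) (SimpleGraph.fromEdgeSet K)) := by
    intro K hK
    have hKe : (SimpleGraph.fromEdgeSet K).edgeSet = K := by
      rw [SimpleGraph.edgeSet_fromEdgeSet, sdiff_eq_left, Set.disjoint_left]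
      exact fun e he => G.not_isDiag_of_mem_edgeSet (hK.1 he)
    have hKG : SimpleGraph.fromEdgeSet K ≤ G := by
      rw [SimpleGraph.fromEdgeSet_le]; exact fun e he => hK.1 he.1
    constructor
    · refine fun h => ⟨⟨hKG, hK.2⟩, fun F hF hle => ?_⟩
      have h1 : IsForestIn G F.edgeSet :=
        ⟨SimpleGraph.edgeSet_mono hF.1, by rw [SimpleGraph.fromEdgeSet_edgeSet]; exact hF.2⟩
      have h2 : K ⊆ F.edgeSet := hKe ▸ SimpleGraph.edgeSet_mono hle
      have h3 : F.edgeSet ⊆ K := h.le_of_ge h1 h2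
      rw [← SimpleGraph.edgeSet_subset_edgeSet, hKe]
      exact h3
    · refine fun h => ⟨hK, fun L hL hle => ?_⟩
      have h1 : SimpleGraph.fromEdgeSet L ≤ G := by
        rw [SimpleGraph.fromEdgeSet_le]; exact fun e he => hL.1 he.1
      have h2 := h.le_of_ge ⟨h1, hL.2⟩ (SimpleGraph.fromEdgeSet_mono hle)
      have h3 := SimpleGraph.edgeSet_mono h2
      rw [hKe, SimpleGraph.edgeSet_fromEdgeSet] at h3
      exact fun e he => h3 ⟨he, G.not_isDiag_of_mem_edgeSet (hL.1 he)⟩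
  apply hImax
  rw [key I hI, SimpleGraph.maximal_isAcyclic_iff_reachable_eq hIG hI.2,
    ← SimpleGraph.reachable_eq_of_maximal_isAcyclic _ ((key B hB.prop).1 hB)]
  have hadj : ∀ x y, (SimpleGraph.fromEdgeSet B).Adj x y →
      (SimpleGraph.fromEdgeSet I).Reachable x y := by
    intro x y hxy
    by_contra hnr
    have hxyB := ((SimpleGraph.fromEdgeSet_adj _).1 hxy)
    have hnI : s(x, y) ∉ I := fun h =>
      hnr (SimpleGraph.Adj.reachable ((SimpleGraph.fromEdgeSet_adj _).2 ⟨h, hxyB.2⟩))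
    refine hcon s(x, y) ⟨hxyB.1, hnI⟩ ⟨?_, ?_⟩
    · exact Set.insert_subset (hB.prop.1 hxyB.1) hI.1
    · have := SimpleGraph.IsAcyclic.sup_edge_of_not_reachable hnr hI.2
      rwa [SimpleGraph.edge, ← SimpleGraph.fromEdgeSet_union, Set.union_singleton] at this
  have hle : ∀ x y, (SimpleGraph.fromEdgeSet B).Reachable x y →
      (SimpleGraph.fromEdgeSet I).Reachable x y := by
    rintro x y ⟨p⟩
    induction p with
    | nil => exact SimpleGraph.Reachable.refl _
    | cons h _ ih => exact (hadj _ _ h).trans ih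
  have hBr := SimpleGraph.reachable_eq_of_maximal_isAcyclic _ ((key B hB.prop).1 hB)
  ext x y
  exact ⟨fun h => hBr ▸ h.mono hIG, hle x y⟩

/-- The graphic matroid of a finite simple graph `G`: the ground set is the edge set of `G`, and a
set of edges is independent if it contains no cycle. -/
def graphicMatroid {V : Type u} [Finite V] (G : SimpleGraph V) : Matroid (Sym2 V) :=
  (IndepMatroid.ofBdd G.edgeSet (IsForestIn G)
    ⟨Set.empty_subset _, by
      rw [SimpleGraph.fromEdgeSet_empty]; exact SimpleGraph.isAcyclic_bot⟩
    (fun _ _ hJ hIJ => ⟨hIJ.trans hJ.1, hJ.2.anti (SimpleGraph.fromEdgeSet_mono hIJ)⟩)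
    (fun _ _ hI hImax hB => hI.exists_insert hImax hB)
    (fun _ hI => hI.1)
    ⟨Nat.card (Sym2 V), fun I _ => by
      rw [← Set.Finite.cast_ncard_eq (Set.toFinite I)]
      exact_mod_cast Set.ncard_le_card I⟩).matroid

/-- The braid matroid `K_n`: the graphic matroid of the complete graph on `n` vertices. -/
def braidMatroid (n : ℕ) : Matroid (Sym2 (Fin n)) :=
  graphicMatroid (⊤ : SimpleGraph (Fin n))

section ChowRing

variable {α : Type u}

/-- The lattice of flats of `M`, ordered by inclusion. -/
abbrev FlatLattice (M : Matroid α) : Type u := {F : Set α // M.IsFlat F}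

/-- A matroid is connected if its lattice of flats cannot be nontrivially decomposed as a
Cartesian product. (If a lattice is order isomorphic to a product of two posets, then these posets
are lattices and the isomorphism is one of lattices.) -/
def IsConnectedMatroid (M : Matroid α) : Prop :=
  ∀ (A B : Type u) [PartialOrder A] [PartialOrder B],
    Nonempty (FlatLattice M ≃o A × B) → Subsingleton A ∨ Subsingleton B

/-- The minimal building set: all nonempty flats `F` such that the restriction `M|F` is
connected. -/
def minimalBuildingSet (M : Matroid α) : Set (Set α) :=
  {F | M.IsFlat F ∧ F.Nonempty ∧ IsConnectedMatroid (M.restrict F)}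

/-- `sup(S, G)`: the join, in the lattice of flats, of the elements of `S` that are strictly smaller
than `G`. The join of a family of flats is the closure of its union. -/
def supBelow (M : Matroid α) {𝒢 : Set (Set α)} (S : Finset 𝒢) (G : 𝒢) : Set α :=
  M.closure (⋃ A ∈ {A : 𝒢 | A ∈ S ∧ (A : Set α) ⊂ G}, (A : Set α))

variable [Finite α]

/-- The ideal of relations of the Chow ring of the matroid `M` with respect to a set `𝒢` of flats:
it is generated by the polynomials
`(∏_{A ∈ S} x_A) * (∑_{H ∈ 𝒢, H ⊇ G} x_H) ^ (rk G - rk (sup(S, G)))`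
for all subsets `S` of `𝒢` and all `G ∈ 𝒢`. As `sup(S, G) ⊆ G`, the subtraction of ranks is never
truncated. -/
noncomputable def chowIdeal (M : Matroid α) (𝒢 : Set (Set α)) : Ideal (MvPolynomial 𝒢 ℚ) :=
  Ideal.span {p | ∃ (S : Finset 𝒢) (G : 𝒢),
    p = (∏ A ∈ S, MvPolynomial.X A) *
      (∑ H ∈ (Set.toFinite {H : 𝒢 | (G : Set α) ⊆ H}).toFinset, MvPolynomial.X H) ^
        ((M.eRk (G : Set α)).toNat - (M.eRk (supBelow M S G)).toNat)}

/-- The Chow ring `D(M, 𝒢)`, a graded quotient of the polynomial ring over `ℚ` whose variables are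
indexed by `𝒢`, all of degree one. -/
abbrev ChowRing (M : Matroid α) (𝒢 : Set (Set α)) : Type u :=
  MvPolynomial 𝒢 ℚ ⧸ chowIdeal M 𝒢

/-- The graded piece `D^i(M, 𝒢)`: the classes of the homogeneous polynomials of degree `i`. -/
noncomputable def chowPiece (M : Matroid α) (𝒢 : Set (Set α)) (i : ℕ) :
    Submodule ℚ (ChowRing M 𝒢) :=
  (MvPolynomial.homogeneousSubmodule 𝒢 ℚ i).map
    (Ideal.Quotient.mkₐ ℚ (chowIdeal M 𝒢)).toLinearMap

/-- The Hilbert series `∑_{i ≥ 0} dim_ℚ D^i(M, 𝒢) x^i` of the Chow ring. -/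
noncomputable def chowHilbertSeries (M : Matroid α) (𝒢 : Set (Set α)) : PowerSeries ℚ :=
  PowerSeries.mk fun i => (Module.finrank ℚ (chowPiece M 𝒢 i) : ℚ)

end ChowRing

/-- The Hilbert series of the Chow ring of the braid matroid `K_n` with respect to its minimal
building set. -/
noncomputable def braidHilbertSeries (n : ℕ) : PowerSeries ℚ :=
  chowHilbertSeries (braidMatroid n) (minimalBuildingSet (braidMatroid n))

/-! The building set consists of the cliques on vertex sets with at least two elements. Putting
`h_A` for the sum of all `x_H` whose vertex set contains `A` and inverting by Möbius, the Chow ring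
acquires the simpler presentation of `BraidRing`: `h_A = 0` for `|A| ≤ 2`, and `(h_A - h_{A ∪ B})
(h_B - h_{A ∪ B}) = 0` when `A` meets `B` (`chowEquivBraid`).

In these generators one vertex can be split off. The ring of `insert v W` is the ring of `W` plus a
complement generated over it by the elements `h_{insert v G}` (`splitEquiv`). That complement is
built abstractly as `FiberModule W`, with a commutative multiplication; the main work is its
associativity (`mul_left_comm_u`), since then its unitization satisfies the braid relations and the
sum is direct.

The Möbius transforms `w_L` of the module generators decompose the module into cyclic pieces indexed
by the `L ⊆ W` with `|L| ≥ 2` (`strataEquiv`). The piece of `L` is the ring of `L` tensored with the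
ring of the set obtained from `W` by collapsing `L` to a point (`tensorEquiv`). As `w_L` has degree
one, counting dimensions with `|W| = n - 1` gives Manin's recursion (`hasHilbertPoly_insert`).
Keel's recursion follows from it by symmetrizing under `j ↦ n - j`, and each recursion expresses
later terms through earlier ones.

Degrees are tracked without graded structures: multiplying all generators by `2` is an endomorphism
acting on degree `i` as `2 ^ i`, so dimensions can be read off from a basis of eigenvectors
(`finrank_eq_card_of_eigenbasis`). -/

section BraidRing

/-! ### The braid ring: presentation and first consequences. -/

variable {α : Type} [DecidableEq α]

/-- The relations between the generators `h_A` of the braid ring of `V`. -/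
def braidRels (V : Finset α) : Set (MvPolynomial (Finset α) ℚ) :=
  {p | ∃ A : Finset α, (¬ A ⊆ V ∨ A.card ≤ 2) ∧ p = MvPolynomial.X A} ∪
  {p | ∃ A B : Finset α, A ⊆ V ∧ B ⊆ V ∧ (A ∩ B).Nonempty ∧
    p = (MvPolynomial.X A - MvPolynomial.X (A ∪ B)) * (MvPolynomial.X B - MvPolynomial.X (A ∪ B))}

/-- The ring generated by elements `h_A` for `A ⊆ V`, subject to `h_A = 0` if `A` has at most two
elements and `(h_A - h_{A ∪ B}) (h_B - h_{A ∪ B}) = 0` if `A` and `B` meet. -/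
def BraidRing (V : Finset α) : Type :=
  MvPolynomial (Finset α) ℚ ⧸ Ideal.span (braidRels V)

noncomputable instance (V : Finset α) : CommRing (BraidRing V) :=
  inferInstanceAs (CommRing (MvPolynomial (Finset α) ℚ ⧸ Ideal.span (braidRels V)))

noncomputable instance (V : Finset α) : Algebra ℚ (BraidRing V) :=
  inferInstanceAs (Algebra ℚ (MvPolynomial (Finset α) ℚ ⧸ Ideal.span (braidRels V)))

/-- A family of elements of a ring that satisfies the relations of the braid ring of `V`. -/
structure IsBraidFamily {B : Type*} [CommRing B] (V : Finset α) (g : Finset α → B) : Prop where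
  eq_zero : ∀ A, ¬ A ⊆ V ∨ A.card ≤ 2 → g A = 0
  mul_eq_zero : ∀ A B, A ⊆ V → B ⊆ V → (A ∩ B).Nonempty →
    (g A - g (A ∪ B)) * (g B - g (A ∪ B)) = 0

namespace BraidRing

/-- The quotient map from the polynomial ring. -/
noncomputable def mk (V : Finset α) : MvPolynomial (Finset α) ℚ →ₐ[ℚ] BraidRing V :=
  Ideal.Quotient.mkₐ ℚ (Ideal.span (braidRels V))

theorem mk_surjective (V : Finset α) : Function.Surjective (mk V) :=
  Ideal.Quotient.mkₐ_surjective ℚ _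

theorem mk_eq_zero_iff (V : Finset α) (p : MvPolynomial (Finset α) ℚ) :
    mk V p = 0 ↔ p ∈ Ideal.span (braidRels V) :=
  Ideal.Quotient.eq_zero_iff_mem

/-- The generator `h_A` of the braid ring. -/
noncomputable def h (V A : Finset α) : BraidRing V := mk V (MvPolynomial.X A)

theorem isBraidFamily_h (V : Finset α) : IsBraidFamily V (h V) where
  eq_zero A hA := (mk_eq_zero_iff _ _).2 (Ideal.subset_span (Or.inl ⟨A, hA, rfl⟩))
  mul_eq_zero A B hA hB hAB := by
    have := (mk_eq_zero_iff V _).2 (Ideal.subset_span (Or.inr ⟨A, B, hA, hB, hAB, rfl⟩))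
    rwa [map_mul, map_sub, map_sub] at this

theorem h_eq_zero {V A : Finset α} (hA : ¬ A ⊆ V ∨ A.card ≤ 2) : h V A = 0 :=
  (isBraidFamily_h V).eq_zero A hA

/-- The universal property of the braid ring. -/
noncomputable def lift {B : Type*} [CommRing B] [Algebra ℚ B] {V : Finset α} {g : Finset α → B}
    (hg : IsBraidFamily V g) : BraidRing V →ₐ[ℚ] B :=
  Ideal.Quotient.liftₐ (Ideal.span (braidRels V)) (MvPolynomial.aeval g) (by
    intro p hp
    have : Ideal.span (braidRels V) ≤ RingHom.ker (MvPolynomial.aeval g : _ →ₐ[ℚ] B) := by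
      rw [Ideal.span_le]
      rintro p (⟨A, hA, rfl⟩ | ⟨A, C, hA, hC, hAC, rfl⟩)
      · simpa using hg.eq_zero A hA
      · simpa using hg.mul_eq_zero A C hA hC hAC
    exact this hp)

@[simp]
theorem lift_h {B : Type*} [CommRing B] [Algebra ℚ B] {V : Finset α} {g : Finset α → B}
    (hg : IsBraidFamily V g) (A : Finset α) : lift hg (h V A) = g A :=
  (Ideal.Quotient.liftₐ_apply _ _ _ _).trans (by
    erw [Ideal.Quotient.lift_mk]
    simp)

theorem induction {V : Finset α} {P : BraidRing V → Prop}
    (of_rat : ∀ c, P (algebraMap ℚ _ c)) (add : ∀ a b, P a → P b → P (a + b))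
    (mul_h : ∀ a A, P a → P (a * h V A)) (a : BraidRing V) : P a := by
  obtain ⟨p, rfl⟩ := mk_surjective V a
  induction p using MvPolynomial.induction_on with
  | C c =>
    exact ((mk V).commutes c).symm ▸ of_rat c
  | add p q hp hq => rw [map_add]; exact add _ _ hp hq
  | mul_X p A hp => rw [map_mul]; exact mul_h _ A hp

theorem algHom_ext {B : Type*} [Semiring B] [Algebra ℚ B] {V : Finset α}
    {f g : BraidRing V →ₐ[ℚ] B} (hfg : ∀ A, A ⊆ V → 2 < A.card → f (h V A) = g (h V A)) :
    f = g := by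
  ext a
  induction a using induction with
  | of_rat c => simp
  | add a b ha hb => simp [ha, hb]
  | mul_h a A ha =>
    rw [map_mul, map_mul, ha]
    by_cases hA : A ⊆ V ∧ 2 < A.card
    · rw [hfg A hA.1 hA.2]
    · rw [h_eq_zero (by rw [← not_lt]; tauto), map_zero, map_zero]

/-- Since `G ⊆ P`, the defining relations for the pairs `H, P` and `G ∪ H, P` involve the same
union, and this is their difference. -/
theorem h_sub_mul_h_sub {V H G P : Finset α} (hH : H ⊆ V) (hP : P ⊆ V) (hGP : G ⊆ P)
    (hHP : (H ∩ P).Nonempty) :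
    (h V H - h V (G ∪ H)) * (h V P - h V (H ∪ P)) = 0 := by
  have h1 := (isBraidFamily_h V).mul_eq_zero H P hH hP hHP
  have h2 := (isBraidFamily_h V).mul_eq_zero (G ∪ H) P (by grind) hP (hHP.mono (by grind))
  have e : G ∪ H ∪ P = H ∪ P := by grind
  rw [e] at h2
  linear_combination h1 - h2

/-- The relation for `{k, p}` and `P`, in which `h_{k,p}` vanishes. This is how the vanishing on
small sets enters most later arguments. -/
theorem h_mul_h_sub {V P : Finset α} (hP : P ⊆ V) {k p : α} (hk : k ∈ V) (hp : p ∈ P) :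
    h V (insert k P) * (h V P - h V (insert k P)) = 0 := by
  have h1 := (isBraidFamily_h V).mul_eq_zero {k, p} P (by grind) hP ⟨p, by grind⟩
  have h2 : h V {k, p} = 0 := h_eq_zero (Or.inr Finset.card_le_two)
  have e : {k, p} ∪ P = insert k P := by grind
  rw [e, h2] at h1
  linear_combination - h1

/-- The map between braid rings that sends `h_A` to `h_A` for `A ⊆ W`. -/
noncomputable def incl {W V : Finset α} (hWV : W ⊆ V) : BraidRing W →ₐ[ℚ] BraidRing V :=
  lift (g := fun A => if A ⊆ W then h V A else 0)
    { eq_zero := fun A hA => by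
        rcases hA with hA | hA
        · rw [if_neg hA]
        · rw [h_eq_zero (Or.inr hA), ite_self]
      mul_eq_zero := fun A B hA hB hAB => by
        rw [if_pos hA, if_pos hB, if_pos (Finset.union_subset hA hB)]
        exact (isBraidFamily_h V).mul_eq_zero A B (hA.trans hWV) (hB.trans hWV) hAB }

theorem incl_h {W V A : Finset α} (hWV : W ⊆ V) (hA : A ⊆ W) :
    incl hWV (h W A) = h V A := by
  rw [incl, lift_h, if_pos hA]

/-- The automorphism that multiplies the generators by `2`. It acts on the homogeneous elements of
degree `i` as multiplication by `2 ^ i`. -/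
noncomputable def scale (V : Finset α) : BraidRing V →ₐ[ℚ] BraidRing V :=
  lift (g := fun A => 2 * h V A)
    { eq_zero := fun A hA => by rw [h_eq_zero hA, mul_zero]
      mul_eq_zero := fun A B hA hB hAB => by
        linear_combination 4 * (isBraidFamily_h V).mul_eq_zero A B hA hB hAB }

@[simp]
theorem scale_h (V A : Finset α) : scale V (h V A) = 2 * h V A := lift_h _ _

theorem scale_incl {W V : Finset α} (hWV : W ⊆ V) (a : BraidRing W) :
    scale V (incl hWV a) = incl hWV (scale W a) := by
  have : (scale V).comp (incl hWV) = (incl hWV).comp (scale W) := by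
    refine algHom_ext fun A hA _ => ?_
    simp only [AlgHom.comp_apply, incl_h hWV hA, scale_h, map_mul, map_ofNat]
  exact DFunLike.congr_fun this a

end BraidRing

/-! ### Möbius inversion over the supersets of a set. -/

/-- The Möbius transform of a function on the subsets of `V`. -/
def mobius {M : Type*} [AddCommGroup M] (V : Finset α) (f : Finset α → M) (A : Finset α) : M :=
  ∑ K ∈ Finset.Icc A V, (-1 : ℤ) ^ (K \ A).card • f K

theorem map_mobius {M N F : Type*} [AddCommGroup M] [AddCommGroup N] [FunLike F M N]
    [AddMonoidHomClass F M N] (φ : F) (V : Finset α) (f : Finset α → M) (A : Finset α) :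
    φ (mobius V f A) = mobius V (fun K => φ (f K)) A := by
  simp only [mobius, map_sum, map_zsmul]

theorem mobius_congr {M : Type*} [AddCommGroup M] {V : Finset α} {f g : Finset α → M}
    {A : Finset α} (hfg : ∀ K, A ⊆ K → K ⊆ V → f K = g K) : mobius V f A = mobius V g A :=
  Finset.sum_congr rfl fun K hK => by
    rw [Finset.mem_Icc] at hK
    rw [hfg K hK.1 hK.2]

/-- Complementation in `K` turns this into the alternating sum over all subsets of `K \ A`. -/
theorem sum_Icc_neg_one_pow_card_sdiff (A K : Finset α) (hAK : A ⊆ K) :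
    ∑ L ∈ Finset.Icc A K, (-1 : ℤ) ^ (K \ L).card = if A = K then 1 else 0 := by
  have h1 : ∑ L ∈ Finset.Icc A K, (-1 : ℤ) ^ (K \ L).card =
      ∑ S ∈ (K \ A).powerset, (-1 : ℤ) ^ S.card := by
    refine Finset.sum_bij' (fun L _ => K \ L) (fun S _ => K \ S) ?_ ?_ ?_ ?_ ?_ <;>
      intro L hL <;> simp only [Finset.mem_Icc, Finset.mem_powerset] at hL ⊢
    · grind
    · grind
    · grind
    · grind
  rw [h1, Finset.sum_powerset_neg_one_pow_card]
  congr 1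
  rw [Finset.sdiff_eq_empty_iff_subset, eq_iff_iff]
  exact ⟨fun h => hAK.antisymm h, fun h => h.ge⟩

theorem sum_mobius {M : Type*} [AddCommGroup M] {V : Finset α} (f : Finset α → M) {A : Finset α}
    (hA : A ⊆ V) : ∑ L ∈ Finset.Icc A V, mobius V f L = f A := by
  simp only [mobius]
  rw [Finset.sum_comm' (t' := Finset.Icc A V) (s' := fun K => Finset.Icc A K)
    (by intro x y; simp only [Finset.mem_Icc]; grind)]
  simp only [← Finset.sum_smul]
  rw [Finset.sum_eq_single A]
  · rw [sum_Icc_neg_one_pow_card_sdiff A A subset_rfl, if_pos rfl, one_smul]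
  · intro K hK hKA
    rw [sum_Icc_neg_one_pow_card_sdiff A K (Finset.mem_Icc.1 hK).1, if_neg hKA.symm, zero_smul]
  · intro hA'
    exact absurd (Finset.mem_Icc.2 ⟨le_rfl, hA⟩) hA'

/-- The system is unitriangular for inclusion, so induction on `|V \ A|` peels off the term at `A`.
-/
theorem eq_of_sum_Icc_eq {M : Type*} [AddCommGroup M] {V : Finset α} {f g : Finset α → M}
    (hfg : ∀ A, A ⊆ V → ∑ L ∈ Finset.Icc A V, f L = ∑ L ∈ Finset.Icc A V, g L) :
    ∀ A, A ⊆ V → f A = g A := by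
  intro A hA
  induction hn : (V \ A).card using Nat.strong_induction_on generalizing A with
  | _ n ih =>
    subst hn
    have h1 := hfg A hA
    rw [← Finset.add_sum_erase _ _ (Finset.mem_Icc.2 ⟨le_rfl, hA⟩),
      ← Finset.add_sum_erase _ _ (Finset.mem_Icc.2 ⟨le_rfl, hA⟩)] at h1
    rw [Finset.sum_congr rfl fun L hL => ?_] at h1
    · exact add_right_cancel h1
    · simp only [Finset.mem_erase, Finset.mem_Icc] at hL
      refine ih _ (Finset.card_lt_card ?_) L hL.2.2 rfl
      rw [Finset.ssubset_iff_subset_ne]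
      refine ⟨by grind, fun h => hL.1 ?_⟩
      rw [← Finset.sdiff_sdiff_eq_self hL.2.2, h, Finset.sdiff_sdiff_eq_self hA]

theorem mobius_sum {M : Type*} [AddCommGroup M] {V : Finset α} (g : Finset α → M) {A : Finset α}
    (hA : A ⊆ V) : mobius V (fun K => ∑ L ∈ Finset.Icc K V, g L) A = g A :=
  eq_of_sum_Icc_eq (fun _ hB => sum_mobius _ hB) A hA

/-- The terms of the Möbius transform at `A` cancel in pairs `K`, `insert q K`. -/
theorem mobius_eq_sum_sub {M : Type*} [AddCommGroup M] {V : Finset α} (f : Finset α → M)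
    {A : Finset α} {q : α} (hq : q ∈ V) (hqA : q ∉ A) :
    mobius V f A = ∑ K ∈ Finset.Icc A (V.erase q),
      (-1 : ℤ) ^ (K \ A).card • (f K - f (insert q K)) := by
  have h1 : Finset.Icc A V = Finset.Icc A (V.erase q) ∪
      (Finset.Icc A (V.erase q)).image (insert q) := by
    ext K
    simp only [Finset.mem_union, Finset.mem_image, Finset.mem_Icc]
    constructor
    · rintro ⟨h1, h2⟩
      by_cases hqK : q ∈ K
      · exact Or.inr ⟨K.erase q, by grind, by grind⟩
      · exact Or.inl (by grind)
    · rintro (h | ⟨L, h, rfl⟩) <;> grind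
  rw [mobius, h1, Finset.sum_union, Finset.sum_image, ← Finset.sum_add_distrib]
  · refine Finset.sum_congr rfl fun K hK => ?_
    rw [Finset.mem_Icc] at hK
    have h2 : insert q K \ A = insert q (K \ A) := by grind
    have h3 : q ∉ K \ A := fun h => by
      have := hK.2 (Finset.mem_sdiff.1 h).1
      simp at this
    rw [h2, Finset.card_insert_of_notMem h3, pow_succ, smul_sub]
    simp [sub_eq_add_neg]
  · intro K hK L hL hKL
    simp only [Finset.coe_Icc, Set.mem_Icc] at hK hL
    have hqK : q ∉ K := fun h => by simpa using hK.2 h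
    have hqL : q ∉ L := fun h => by simpa using hL.2 h
    rw [← Finset.erase_insert hqK, hKL, Finset.erase_insert hqL]
  · rw [Finset.disjoint_left]
    intro K hK hK'
    simp only [Finset.mem_image, Finset.mem_Icc] at hK hK'
    grind

end BraidRing

/-! ### The fiber module and its multiplication. -/

section FiberModule

variable {α : Type} [DecidableEq α]

open BraidRing

/-- The relations between the generators `u_G` of the fiber module. -/
noncomputable def fiberRels (W : Finset α) : Submodule (BraidRing W) (Finset α →₀ BraidRing W) :=
  Submodule.span (BraidRing W)
    ({p | ∃ G : Finset α, (¬ G ⊆ W ∨ G.card ≤ 1) ∧ p = Finsupp.single G 1} ∪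
    {p | ∃ H G : Finset α, H ⊆ W ∧ G ⊆ W ∧ (H ∩ G).Nonempty ∧
      p = (h W H - h W (G ∪ H)) • (Finsupp.single G 1 - Finsupp.single (G ∪ H) 1)})

/-- The module over the braid ring of `W` with generators `u_G`. It is the complement of the braid
ring of `W` in the braid ring of a set with one more element. -/
def FiberModule (W : Finset α) : Type := (Finset α →₀ BraidRing W) ⧸ fiberRels W

/-- A family of elements of a module that satisfies the relations of the fiber module. -/
structure IsFiberFamily {M : Type*} (W : Finset α) [AddCommGroup M] [Module (BraidRing W) M]
    (g : Finset α → M) : Prop where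
  eq_zero : ∀ G, ¬ G ⊆ W ∨ G.card ≤ 1 → g G = 0
  smul_sub : ∀ H G, H ⊆ W → G ⊆ W → (H ∩ G).Nonempty →
    (h W H - h W (G ∪ H)) • (g G - g (G ∪ H)) = 0

namespace FiberModule

noncomputable instance (W : Finset α) : AddCommGroup (FiberModule W) :=
  inferInstanceAs (AddCommGroup ((Finset α →₀ BraidRing W) ⧸ fiberRels W))

noncomputable instance (W : Finset α) : Module (BraidRing W) (FiberModule W) :=
  inferInstanceAs (Module (BraidRing W) ((Finset α →₀ BraidRing W) ⧸ fiberRels W))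

noncomputable instance (W : Finset α) : Module ℚ (FiberModule W) :=
  inferInstanceAs (Module ℚ ((Finset α →₀ BraidRing W) ⧸ fiberRels W))

instance (W : Finset α) : IsScalarTower ℚ (BraidRing W) (FiberModule W) :=
  inferInstanceAs (IsScalarTower ℚ (BraidRing W) ((Finset α →₀ BraidRing W) ⧸ fiberRels W))

/-- The quotient map. -/
noncomputable def mk (W : Finset α) : (Finset α →₀ BraidRing W) →ₗ[BraidRing W] FiberModule W :=
  (fiberRels W).mkQ

/-- The generators of the fiber module. -/
noncomputable def u (W G : Finset α) : FiberModule W := mk W (Finsupp.single G 1)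

theorem mk_eq_zero {W : Finset α} {p : Finset α →₀ BraidRing W} (hp : p ∈ fiberRels W) :
    mk W p = 0 :=
  (Submodule.Quotient.mk_eq_zero _).2 hp

theorem isFiberFamily_u (W : Finset α) : IsFiberFamily W (u W) where
  eq_zero G hG := mk_eq_zero (Submodule.subset_span (Or.inl ⟨G, hG, rfl⟩))
  smul_sub H G hH hG hHG := by
    have := mk_eq_zero (Submodule.subset_span (Or.inr ⟨H, G, hH, hG, hHG, rfl⟩))
    rwa [map_smul, map_sub] at this

theorem u_eq_zero {W G : Finset α} (hG : ¬ G ⊆ W ∨ G.card ≤ 1) : u W G = 0 :=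
  (isFiberFamily_u W).eq_zero G hG

/-- The universal property of the fiber module. -/
noncomputable def lift {M : Type*} {W : Finset α} [AddCommGroup M] [Module (BraidRing W) M]
    {g : Finset α → M} (hg : IsFiberFamily W g) : FiberModule W →ₗ[BraidRing W] M :=
  (fiberRels W).liftQ (Finsupp.linearCombination (BraidRing W) g) (by
    rw [fiberRels, Submodule.span_le]
    rintro p (⟨G, hG, rfl⟩ | ⟨H, G, hH, hG, hHG, rfl⟩)
    · simpa using hg.eq_zero G hG
    · simpa using hg.smul_sub H G hH hG hHG)

@[simp]
theorem lift_u {M : Type*} {W : Finset α} [AddCommGroup M] [Module (BraidRing W) M]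
    {g : Finset α → M} (hg : IsFiberFamily W g) (G : Finset α) : lift hg (u W G) = g G :=
  (Submodule.liftQ_apply _ _ _).trans (by simp)

theorem induction {W : Finset α} {P : FiberModule W → Prop} (zero : P 0)
    (add : ∀ m n, P m → P n → P (m + n))
    (smul_u : ∀ (a : BraidRing W) (G : Finset α), G ⊆ W → 2 ≤ G.card → P (a • u W G)) (m : FiberModule W) : P m := by
  obtain ⟨p, rfl⟩ := Submodule.mkQ_surjective _ m
  change P (mk W p)
  induction p using Finsupp.induction_linear with
  | zero => rw [map_zero]; exact zero
  | add p q hp hq => rw [map_add]; exact add _ _ hp hq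
  | single G a =>
    have : mk W (Finsupp.single G a) = a • u W G := by
      rw [u, ← map_smul, Finsupp.smul_single_one]
    rw [this]
    by_cases hG : G ⊆ W ∧ 2 ≤ G.card
    · exact smul_u a G hG.1 hG.2
    · rw [u_eq_zero (by rw [← not_lt]; tauto), smul_zero]
      exact zero

theorem linearMap_ext {M : Type*} {W : Finset α} [AddCommGroup M] [Module (BraidRing W) M]
    {f g : FiberModule W →ₗ[BraidRing W] M}
    (hfg : ∀ G, G ⊆ W → 2 ≤ G.card → f (u W G) = g (u W G)) : f = g := by
  ext m
  induction m using FiberModule.induction with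
  | zero => simp
  | add m n hm hn => rw [map_add, map_add, hm, hn]
  | smul_u a G hG hG2 => rw [map_smul, map_smul, hfg G hG hG2]

/-- Relations that follow from the defining ones by taking differences. -/
theorem smul_sub_of_subset {W H K G G' : Finset α} (hH : H ⊆ W) (hG : G ⊆ W) (hG' : G' ⊆ W)
    (hK : K ⊆ W) (hHG : (H ∩ G).Nonempty) (hGG' : G ⊆ G') (hHK : H ⊆ K) (hKG : K ⊆ G ∪ H)
    (hG'H : G' ⊆ G ∪ H) :
    (h W H - h W K) • (u W G - u W G') = 0 := by
  have e1 : G' ∪ H = G ∪ H := by grind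
  have e2 : G ∪ K = G ∪ H := by grind
  have e3 : G' ∪ K = G ∪ H := by grind
  have h1 := (isFiberFamily_u W).smul_sub H G hH hG hHG
  have h2 := (isFiberFamily_u W).smul_sub H G' hH hG' (hHG.mono (by grind))
  have h3 := (isFiberFamily_u W).smul_sub K G hK hG (hHG.mono (by grind))
  have h4 := (isFiberFamily_u W).smul_sub K G' hK hG' (hHG.mono (by grind))
  rw [e1] at h2
  rw [e2] at h3
  rw [e3] at h4
  linear_combination (norm := module) h1 - h2 - h3 + h4

/-- Join `K` to a point `g` of `G`: the resulting set has at most two elements, so its `h` vanishes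
in the relation it forms with `G`. -/
theorem h_smul_u_sub {W G K : Finset α} (hG : G ⊆ W) (hK : K ⊆ W) (hGne : G.Nonempty)
    (hK1 : K.card ≤ 1) : h W (G ∪ K) • (u W G - u W (G ∪ K)) = 0 := by
  obtain ⟨g, hg⟩ := hGne
  have h1 := smul_sub_of_subset (W := W) (H := insert g K) (K := G ∪ K) (G := G) (G' := G ∪ K)
    (by grind) hG (by grind) (by grind) ⟨g, by grind⟩ (by grind) (by grind) (by grind) (by grind)
  have h2 : h W (insert g K) = 0 :=
    h_eq_zero (Or.inr ((Finset.card_insert_le _ _).trans (by omega)))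
  rw [h2, zero_sub, neg_smul, neg_eq_zero] at h1
  exact h1

/-- The product of two generators. -/
noncomputable def mulGen (W G H : Finset α) : FiberModule W :=
  h W (G ∪ H) • (u W G + u W H - u W (G ∪ H))

theorem mulGen_comm (W G H : Finset α) : mulGen W G H = mulGen W H G := by
  rw [mulGen, mulGen, Finset.union_comm, add_comm (u W G)]

/-- The product respects the relations in one argument. By symmetry this suffices for a bilinear
product on the quotient. -/
theorem isFiberFamily_mulGen (W K : Finset α) : IsFiberFamily W (fun G => mulGen W G K) where
  eq_zero G hG := by
    by_cases hGK : G ∪ K ⊆ W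
    · have hG1 : G.card ≤ 1 := hG.resolve_left (by grind)
      rw [mulGen, u_eq_zero hG, zero_add]
      rcases K.eq_empty_or_nonempty with rfl | hK
      · rw [Finset.union_empty, h_eq_zero (Or.inr (by omega)), zero_smul]
      · rw [Finset.union_comm]
        exact h_smul_u_sub (by grind) (by grind) hK hG1
    · rw [mulGen, h_eq_zero (Or.inl hGK), zero_smul]
  smul_sub H G hH hG hHG := by
    by_cases hK : K ⊆ W
    · simp only [mulGen]
      have e : G ∪ H ∪ K = H ∪ (G ∪ K) := by grind
      have e2 : H ∪ G = G ∪ H := by grind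
      have h1 := h_sub_mul_h_sub (V := W) (H := H) (G := G) (P := G ∪ K) hH (by grind) (by grind)
        (hHG.mono (by grind))
      rw [e]
      have h2 := smul_sub_of_subset (W := W) (H := H) (K := G ∪ H) (G := G) (G' := G ∪ H) hH hG
        (by grind) (by grind) hHG (by grind) (by grind) (by grind) (by grind)
      have h3 := smul_sub_of_subset (W := W) (H := H) (K := G ∪ H) (G := G ∪ K)
        (G' := H ∪ (G ∪ K)) hH (by grind)
        (by grind) (by grind) (hHG.mono (by grind)) (by grind) (by grind) (by grind) (by grind)
      linear_combination (norm := module) h1 • (u W G + u W K - u W (G ∪ K)) +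
        h W (H ∪ (G ∪ K)) • h2 - h W (H ∪ (G ∪ K)) • h3
    · rw [mulGen, mulGen, h_eq_zero (A := G ∪ K) (Or.inl (by grind)),
        h_eq_zero (A := G ∪ H ∪ K) (Or.inl (by grind))]
      simp

/-- The multiplication of the fiber module. -/
noncomputable def mulMap (W : Finset α) :
    FiberModule W →ₗ[BraidRing W] FiberModule W →ₗ[BraidRing W] FiberModule W :=
  lift (g := fun K => lift (isFiberFamily_mulGen W K))
    { eq_zero := fun K hK => linearMap_ext fun G _ _ => by
        rw [lift_u, mulGen_comm, (isFiberFamily_mulGen W G).eq_zero K hK, LinearMap.zero_apply]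
      smul_sub := fun H K hH hK hHK => linearMap_ext fun G _ _ => by
        have := (isFiberFamily_mulGen W G).smul_sub H K hH hK hHK
        simpa only [LinearMap.smul_apply, LinearMap.sub_apply, lift_u, LinearMap.zero_apply,
          mulGen_comm W G] using this }

noncomputable instance (W : Finset α) : Mul (FiberModule W) := ⟨fun m n => mulMap W m n⟩

theorem mul_def {W : Finset α} (m n : FiberModule W) : m * n = mulMap W m n := rfl

/-- The formula is dictated by the products of the elements `h_{insert v G}` in the braid ring of
`insert v W`; see `toBraidRing_mul`. -/
theorem u_mul_u (W G H : Finset α) :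
    u W G * u W H = h W (G ∪ H) • (u W G + u W H - u W (G ∪ H)) := by
  rw [mul_def, mulMap, lift_u, lift_u, mulGen_comm, mulGen]

theorem u_mul_u_of_subset {W G H : Finset α} (hGH : G ⊆ H) : u W G * u W H = h W H • u W G := by
  rw [u_mul_u, Finset.union_eq_right.2 hGH, add_sub_cancel_right]

theorem smul_mul (W : Finset α) (a : BraidRing W) (m n : FiberModule W) :
    (a • m) * n = a • (m * n) := by
  rw [mul_def, mul_def, map_smul, LinearMap.smul_apply]

theorem mul_smul' (W : Finset α) (a : BraidRing W) (m n : FiberModule W) :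
    m * (a • n) = a • (m * n) := by
  rw [mul_def, mul_def, map_smul]

theorem add_mul' {W : Finset α} (m n p : FiberModule W) : (m + n) * p = m * p + n * p := by
  simp only [mul_def, map_add, LinearMap.add_apply]

theorem mul_add' {W : Finset α} (m n p : FiberModule W) : m * (n + p) = m * n + m * p := by
  simp only [mul_def, map_add]

theorem mul_comm' {W : Finset α} (m n : FiberModule W) : m * n = n * m := by
  have : mulMap W = (mulMap W).flip := linearMap_ext fun G _ _ => linearMap_ext fun H _ _ => by
    rw [LinearMap.flip_apply, mulMap, lift_u, lift_u, lift_u, lift_u, mulGen_comm]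
  rw [mul_def, mul_def]
  nth_rewrite 1 [this]
  rfl

/-- No intersection of `K` and `P` is needed. The set `insert k P` with `k ∈ K` meets both, and the
extra factor `h_{K ∪ P}` allows passing through it. -/
theorem h_smul_h_sub_smul_u_sub {W P K : Finset α} (hP : P ⊆ W) (hK : K ⊆ W) (hPne : P.Nonempty)
    (hKne : K.Nonempty) :
    h W (K ∪ P) • (h W P - h W (K ∪ P)) • (u W K - u W (K ∪ P)) = 0 := by
  obtain ⟨k, hk⟩ := hKne
  obtain ⟨p, hp⟩ := hPne
  have h1 := h_mul_h_sub hP (hK hk) hp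
  have h2 := smul_sub_of_subset (W := W) (H := insert k P) (K := K ∪ P) (G := K) (G' := K ∪ P)
    (by grind) hK (by grind) (by grind) ⟨k, by grind⟩ (by grind) (by grind) (by grind) (by grind)
  linear_combination (norm := module) h1 • (u W K - u W (K ∪ P)) - (h W P - h W (K ∪ P) -
    h W (insert k P)) • h2

/-- Associativity of the product on generators as pure linear algebra: `a`, `b`, `c`, `s` stand for
`h` of `G ∪ H`, `K ∪ H`, `K ∪ G`, `K ∪ G ∪ H`. -/
theorem smul_comb_eq_of_relations {R M : Type*} [CommRing R] [AddCommGroup M] [Module R M]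
    {a b c s : R} {uK uG uH uKG uKH uGH us : M}
    (R1 : (a - s) * (b - s) = 0) (R2 : (a - s) * (c - s) = 0) (R3 : (b - s) * (c - s) = 0)
    (M1 : (a - s) • (uKH - us) = 0) (M2 : (a - s) • (uKG - us) = 0)
    (M3 : (b - s) • (uGH - us) = 0) (M4 : (b - s) • (uKG - us) = 0)
    (Q1 : s • (a - s) • (uK - us) = 0) (Q2 : s • (b - s) • (uG - us) = 0) :
    a • (c • (uK + uG - uKG) + b • (uK + uH - uKH) - s • (uK + uGH - us)) =
      b • (c • (uG + uK - uKG) + a • (uG + uH - uGH) - s • (uG + uKH - us)) := by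
  linear_combination (norm := module) (R2 - R3) • (uK + uG - uKG) +
    R1 • (uK - uKH - uG + uGH) - s • M2 + s • M4 + Q1 - Q2 - s • M1 + s • M3

/-- Even if `K`, `G`, `H` are disjoint, their pairwise unions meet each other and any two of them
have union `K ∪ G ∪ H`. So the defining relations apply to these unions. Together with commutativity
this gives associativity. -/
theorem mul_left_comm_u {W K G H : Finset α} (hK : K ⊆ W) (hG : G ⊆ W) (hH : H ⊆ W)
    (hKne : K.Nonempty) (hGne : G.Nonempty) (hHne : H.Nonempty) :
    u W K * (u W G * u W H) = u W G * (u W K * u W H) := by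
  have expand : ∀ K G H : Finset α, u W K * (u W G * u W H) =
      h W (G ∪ H) • (h W (K ∪ G) • (u W K + u W G - u W (K ∪ G)) +
        h W (K ∪ H) • (u W K + u W H - u W (K ∪ H)) -
        h W (K ∪ (G ∪ H)) • (u W K + u W (G ∪ H) - u W (K ∪ (G ∪ H)))) := by
    intro K G H
    rw [u_mul_u W G H, mul_smul', sub_eq_add_neg, mul_add', mul_add',
      ← neg_one_smul (BraidRing W), mul_smul', u_mul_u, u_mul_u, u_mul_u, neg_one_smul,
      ← sub_eq_add_neg]
  have e1 : G ∪ (K ∪ H) = K ∪ (G ∪ H) := by grind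
  have e2 : G ∪ H ∪ (K ∪ H) = K ∪ (G ∪ H) := by grind
  have e3 : G ∪ H ∪ (K ∪ G) = K ∪ (G ∪ H) := by grind
  have e4 : K ∪ H ∪ (K ∪ G) = K ∪ (G ∪ H) := by grind
  have e5 : K ∪ H ∪ (G ∪ H) = K ∪ (G ∪ H) := by grind
  have e6 : K ∪ G ∪ (G ∪ H) = K ∪ (G ∪ H) := by grind
  have e7 : K ∪ G ∪ (K ∪ H) = K ∪ (G ∪ H) := by grind
  have mKG : (K ∪ G) ⊆ W := by grind
  have mGH : (G ∪ H) ⊆ W := by grind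
  have mKH : (K ∪ H) ⊆ W := by grind
  have n1 : ((G ∪ H) ∩ (K ∪ H)).Nonempty :=
    let ⟨x, hx⟩ := hHne; ⟨x, by simp [hx]⟩
  have n2 : ((G ∪ H) ∩ (K ∪ G)).Nonempty :=
    let ⟨x, hx⟩ := hGne; ⟨x, by simp [hx]⟩
  have n3 : ((K ∪ H) ∩ (K ∪ G)).Nonempty :=
    let ⟨x, hx⟩ := hKne; ⟨x, by simp [hx]⟩
  have n4 : ((K ∪ H) ∩ (G ∪ H)).Nonempty :=
    let ⟨x, hx⟩ := hHne; ⟨x, by simp [hx]⟩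
  have R1 := (isBraidFamily_h W).mul_eq_zero (G ∪ H) (K ∪ H) mGH mKH n1
  have R2 := (isBraidFamily_h W).mul_eq_zero (G ∪ H) (K ∪ G) mGH mKG n2
  have R3 := (isBraidFamily_h W).mul_eq_zero (K ∪ H) (K ∪ G) mKH mKG n3
  have M1 := (isFiberFamily_u W).smul_sub (G ∪ H) (K ∪ H) mGH mKH n1
  have M2 := (isFiberFamily_u W).smul_sub (G ∪ H) (K ∪ G) mGH mKG n2
  have M3 := (isFiberFamily_u W).smul_sub (K ∪ H) (G ∪ H) mKH mGH n4
  have M4 := (isFiberFamily_u W).smul_sub (K ∪ H) (K ∪ G) mKH mKG n3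
  have Q1 := h_smul_h_sub_smul_u_sub mGH hK (hGne.mono Finset.subset_union_left) hKne
  have Q2 := h_smul_h_sub_smul_u_sub mKH hG (hHne.mono Finset.subset_union_right) hGne
  rw [e2] at R1
  rw [e3] at R2
  rw [e4] at R3
  rw [e5] at M1
  rw [e6] at M2
  rw [e2] at M3
  rw [e7] at M4
  rw [e1] at Q2
  rw [expand K G H, expand G K H, e1, Finset.union_comm G K]
  exact smul_comb_eq_of_relations R1 R2 R3 M1 M2 M3 M4 Q1 Q2

theorem mul_left_comm' {W : Finset α} (m n p : FiberModule W) :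
    m * (n * p) = n * (m * p) := by
  induction m using FiberModule.induction with
  | zero => simp only [mul_def, map_zero, LinearMap.zero_apply]
  | add m m' hm hm' => rw [add_mul', hm, hm', add_mul', mul_add']
  | smul_u a K hK hK2 =>
    rw [smul_mul, smul_mul, mul_smul']
    congr 1
    induction n using FiberModule.induction with
    | zero => simp only [mul_def, map_zero, LinearMap.zero_apply]
    | add m m' hm hm' => rw [add_mul', mul_add', hm, hm', add_mul']
    | smul_u a G hG hG2 =>
      rw [smul_mul, smul_mul, mul_smul']
      congr 1
      induction p using FiberModule.induction with
      | zero => simp only [mul_def, map_zero]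
      | add m m' hm hm' => rw [mul_add', mul_add', hm, hm', mul_add', mul_add']
      | smul_u a H hH hH2 =>
        simp only [mul_smul']
        rw [mul_left_comm_u hK hG hH] <;> rw [← Finset.card_pos] <;> omega

noncomputable instance (W : Finset α) : NonUnitalCommRing (FiberModule W) where
  left_distrib := mul_add'
  right_distrib := add_mul'
  zero_mul m := by simp only [mul_def, map_zero, LinearMap.zero_apply]
  mul_zero m := by simp only [mul_def, map_zero]
  mul_assoc m n p := by rw [mul_comm' _ p, mul_left_comm', mul_comm' p n]
  mul_comm := mul_comm'

instance (W : Finset α) : IsScalarTower (BraidRing W) (FiberModule W) (FiberModule W) :=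
  ⟨fun a m n => smul_mul W a m n⟩

instance (W : Finset α) : SMulCommClass (BraidRing W) (FiberModule W) (FiberModule W) :=
  ⟨fun a m n => (mul_smul' W a m n).symm⟩

end FiberModule

open FiberModule

/-- This yields a ring map out of the braid ring of `insert v W` that separates the two summands.
The absorption rule `u_G * u_H = h_H • u_G` for `G ⊆ H` turns the mixed braid relations, where only
one of the sets contains `v`, into the fiber relations. -/
theorem FiberModule.isBraidFamily_unitization {W : Finset α} {v : α} (hv : v ∉ W) :
    IsBraidFamily (insert v W) (fun A => if v ∈ A
      then (Unitization.inr (u W (A.erase v)) : Unitization (BraidRing W) (FiberModule W))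
      else Unitization.inl (h W A)) := by
  have key : ∀ A B : Finset α, A ⊆ insert v W → B ⊆ insert v W → (A ∩ B).Nonempty → v ∈ A →
      v ∉ B → ((Unitization.inr (u W (A.erase v)) -
        Unitization.inr (u W ((A ∪ B).erase v)) : Unitization (BraidRing W) (FiberModule W))) *
        (Unitization.inl (h W B) - Unitization.inr (u W ((A ∪ B).erase v))) = 0 := by
    intro A B hA hB hAB hvA hvB
    have e : (A ∪ B).erase v = A.erase v ∪ B := by grind
    have h1 := (isFiberFamily_u W).smul_sub B (A.erase v) (by grind) (by grind)
      (hAB.mono (by grind))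
    rw [e, ← Unitization.inr_sub, mul_sub, Unitization.inr_mul_inl, ← Unitization.inr_mul,
      ← Unitization.inr_sub, ← Unitization.inr_zero, Unitization.inr_injective.eq_iff, sub_mul,
      u_mul_u_of_subset Finset.subset_union_left, u_mul_u_of_subset subset_rfl]
    linear_combination (norm := module) h1
  refine ⟨fun A hA => ?_, fun A B hA hB hAB => ?_⟩
  · split_ifs with hvA
    · rw [u_eq_zero, Unitization.inr_zero]
      rcases hA with hA | hA
      · exact Or.inl (by grind)
      · exact Or.inr (by rw [Finset.card_erase_of_mem hvA]; omega)
    · rw [h_eq_zero, Unitization.inl_zero]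
      exact hA.imp_left (by grind)
  · by_cases hvA : v ∈ A <;> by_cases hvB : v ∈ B
    · have e : (A ∪ B).erase v = A.erase v ∪ B.erase v := by grind
      rw [if_pos hvA, if_pos hvB, if_pos (by grind), e, ← Unitization.inr_sub,
        ← Unitization.inr_sub, ← Unitization.inr_mul, ← Unitization.inr_zero,
        Unitization.inr_injective.eq_iff, sub_mul, mul_sub, mul_sub,
        u_mul_u_of_subset Finset.subset_union_left, u_mul_u_of_subset subset_rfl, u_mul_u,
        mul_comm (u W (A.erase v ∪ B.erase v)), u_mul_u_of_subset Finset.subset_union_right]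
      module
    · rw [if_pos hvA, if_neg hvB, if_pos (by grind)]
      exact key A B hA hB hAB hvA hvB
    · rw [if_neg hvA, if_pos hvB, if_pos (by grind), mul_comm, Finset.union_comm]
      exact key B A hB hA (Finset.inter_comm A B ▸ hAB) hvB hvA
    · rw [if_neg hvA, if_neg hvB, if_neg (by grind), ← Unitization.inl_sub,
        ← Unitization.inl_sub, ← Unitization.inl_mul,
        (isBraidFamily_h W).mul_eq_zero A B (by grind) (by grind) hAB, Unitization.inl_zero]

end FiberModule

/-! ### Splitting off one vertex. -/

section Splitting

variable {α : Type} [DecidableEq α]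

open BraidRing FiberModule

namespace FiberModule

/-- The algebra structure given by the inclusion of braid rings. -/
noncomputable abbrev inclAlgebra {W V : Finset α} (hWV : W ⊆ V) :
    Algebra (BraidRing W) (BraidRing V) :=
  (incl hWV).toAlgebra

theorem isFiberFamily_h_insert {W : Finset α} {v : α} (hv : v ∉ W) :
    letI := inclAlgebra (Finset.subset_insert v W)
    IsFiberFamily W (fun G => if G ⊆ W then h (insert v W) (insert v G) else 0) := by
  letI := inclAlgebra (Finset.subset_insert v W)
  refine ⟨fun G hG => ?_, fun H G hH hG hHG => ?_⟩
  · split_ifs with hGW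
    · have := hG.resolve_left (not_not.2 hGW)
      exact h_eq_zero (Or.inr ((Finset.card_insert_le _ _).trans (by omega)))
    · rfl
  · rw [if_pos hG, if_pos (by grind), Algebra.smul_def, map_sub]
    change (incl _ (h W H) - incl _ (h W (G ∪ H))) * _ = 0
    rw [incl_h _ hH, incl_h _ (by grind)]
    have h1 := h_sub_mul_h_sub (V := insert v W) (H := H) (G := G) (P := insert v G)
      (by grind) (by grind) (by grind) (hHG.mono (by grind))
    have e : H ∪ insert v G = insert v (G ∪ H) := by grind
    rwa [e] at h1

/-- The map from the fiber module of `W` to the braid ring of `insert v W` that sends `u_G` to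
`h_{insert v G}`. -/
noncomputable def toBraidRing (W : Finset α) {v : α} (hv : v ∉ W) :
    FiberModule W →ₗ[ℚ] BraidRing (insert v W) :=
  letI := inclAlgebra (Finset.subset_insert v W)
  AddMonoidHom.toRatLinearMap (lift (isFiberFamily_h_insert hv)).toAddMonoidHom

theorem toBraidRing_u {W G : Finset α} {v : α} (hv : v ∉ W) (hG : G ⊆ W) :
    toBraidRing W hv (u W G) = h (insert v W) (insert v G) := by
  letI := inclAlgebra (Finset.subset_insert v W)
  exact (lift_u (isFiberFamily_h_insert hv) G).trans (if_pos hG)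

theorem toBraidRing_smul {W : Finset α} {v : α} (hv : v ∉ W) (a : BraidRing W)
    (m : FiberModule W) :
    toBraidRing W hv (a • m) = incl (Finset.subset_insert v W) a * toBraidRing W hv m := by
  letI := inclAlgebra (Finset.subset_insert v W)
  exact (map_smul (lift (isFiberFamily_h_insert hv)) a m).trans (Algebra.smul_def _ _)

/-- By bilinearity only generators matter. There the product is read off from the relation for
`insert v G` and `insert v H`. -/
theorem toBraidRing_mul {W : Finset α} {v : α} (hv : v ∉ W) (m n : FiberModule W) :
    toBraidRing W hv (m * n) = toBraidRing W hv m * toBraidRing W hv n := by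
  induction m using FiberModule.induction with
  | zero => simp
  | add m m' hm hm' => rw [add_mul, map_add, hm, hm', map_add, add_mul]
  | smul_u a G hG hG2 =>
    rw [smul_mul_assoc, toBraidRing_smul, toBraidRing_smul, mul_assoc]
    congr 1
    induction n using FiberModule.induction with
    | zero => simp
    | add m m' hm hm' => rw [mul_add, map_add, hm, hm', map_add, mul_add]
    | smul_u a H hH hH2 =>
      rw [mul_smul_comm, toBraidRing_smul, toBraidRing_smul, mul_left_comm]
      congr 1
      have hGH : G ∪ H ⊆ W := Finset.union_subset hG hH
      obtain ⟨x, hx⟩ : G.Nonempty := by rw [← Finset.card_pos]; omega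
      obtain ⟨y, hy⟩ : H.Nonempty := by rw [← Finset.card_pos]; omega
      -- Absorption: compare the relations of `B` with `insert v A` and with `{a, v}`. Both unions
      -- are `insert v B`, and `h_{a,v} = 0`.
      have key : ∀ A B : Finset α, A ⊆ W → B ⊆ W → A ⊆ B → A.Nonempty →
          h (insert v W) (insert v A) * h (insert v W) (insert v B) =
            h (insert v W) B * h (insert v W) (insert v A) := by
        intro A B hA hB hAB ⟨a, ha⟩
        have r1 := (isBraidFamily_h (insert v W)).mul_eq_zero (insert v A) B (by grind)
          (by grind) ⟨a, by grind⟩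
        have r2 := (isBraidFamily_h (insert v W)).mul_eq_zero {a, v} B (by grind) (by grind)
          ⟨a, by grind⟩
        have e1 : insert v A ∪ B = insert v B := by grind
        have e2 : {a, v} ∪ B = insert v B := by grind
        rw [e1] at r1
        rw [e2, h_eq_zero (Or.inr Finset.card_le_two)] at r2
        linear_combination - r1 + r2
      have r := (isBraidFamily_h (insert v W)).mul_eq_zero (insert v G) (insert v H) (by grind)
        (by grind) ⟨v, by grind⟩
      have e : insert v G ∪ insert v H = insert v (G ∪ H) := by grind
      rw [e] at r
      rw [u_mul_u, toBraidRing_smul, map_sub, map_add, toBraidRing_u hv hG, toBraidRing_u hv hH,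
        toBraidRing_u hv hGH, incl_h _ hGH]
      linear_combination - r + key G _ hG hGH Finset.subset_union_left ⟨x, hx⟩ * (-1) -
        key H _ hH hGH Finset.subset_union_right ⟨y, hy⟩ +
        key _ _ hGH hGH subset_rfl ⟨x, by grind⟩

/-- The map from the braid ring of `insert v W` to the unitization of the fiber module. -/
noncomputable def toUnitization (W : Finset α) {v : α} (hv : v ∉ W) :
    BraidRing (insert v W) →ₐ[ℚ] Unitization (BraidRing W) (FiberModule W) :=
  BraidRing.lift (isBraidFamily_unitization hv)

theorem toUnitization_incl {W : Finset α} {v : α} (hv : v ∉ W) (a : BraidRing W) :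
    toUnitization W hv (incl (Finset.subset_insert v W) a) = Unitization.inl a := by
  have : (toUnitization W hv).comp (incl (Finset.subset_insert v W)) =
      (Unitization.inlRingHom (BraidRing W) (FiberModule W)).toRatAlgHom := by
    refine BraidRing.algHom_ext fun A hA _ => ?_
    rw [AlgHom.comp_apply, incl_h _ hA, toUnitization, BraidRing.lift_h, if_neg fun h => hv (hA h)]
    rfl
  exact DFunLike.congr_fun this a

theorem toUnitization_toBraidRing {W : Finset α} {v : α} (hv : v ∉ W) (m : FiberModule W) :
    toUnitization W hv (toBraidRing W hv m) = Unitization.inr m := by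
  induction m using FiberModule.induction with
  | zero => simp
  | add m n hm hn => rw [map_add, map_add, hm, hn, Unitization.inr_add]
  | smul_u a G hG _ =>
    rw [toBraidRing_smul, map_mul, toUnitization_incl, toBraidRing_u hv hG, toUnitization,
      BraidRing.lift_h, if_pos (Finset.mem_insert_self _ _),
      Finset.erase_insert fun h => hv (hG h), Unitization.inl_mul_inr]

/-- The splitting of the braid ring of `insert v W` as a module. -/
noncomputable def splitEquiv (W : Finset α) {v : α} (hv : v ∉ W) :
    (BraidRing W × FiberModule W) ≃ₗ[ℚ] BraidRing (insert v W) :=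
  LinearEquiv.ofBijective
    ((incl (Finset.subset_insert v W)).toLinearMap.coprod (toBraidRing W hv)) (by
    constructor
    -- Injectivity: `toUnitization` recovers both components.
    · intro x y hxy
      have := congrArg (toUnitization W hv) hxy
      simp only [LinearMap.coprod_apply, AlgHom.toLinearMap_apply, map_add, toUnitization_incl,
        toUnitization_toBraidRing] at this
      ext
      · simpa using congrArg (fun x => x.fst) this
      · simpa using congrArg (fun x => x.snd) this
    -- Surjectivity: the image contains the constants and is stable under multiplication by each
    -- generator, as the fiber part is closed under products.
    · intro p
      induction p using BraidRing.induction with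
      | of_rat c => exact ⟨(algebraMap ℚ _ c, 0), by simp⟩
      | add a b ha hb =>
        obtain ⟨x, rfl⟩ := ha
        obtain ⟨y, rfl⟩ := hb
        exact ⟨x + y, map_add _ _ _⟩
      | mul_h p A hp =>
        obtain ⟨⟨a, m⟩, rfl⟩ := hp
        by_cases hA : A ⊆ insert v W
        · by_cases hvA : v ∈ A
          · refine ⟨(0, a • u W (A.erase v) + m * u W (A.erase v)), ?_⟩
            simp only [LinearMap.coprod_apply, AlgHom.toLinearMap_apply, map_add, map_zero,
              toBraidRing_smul, toBraidRing_mul, zero_add]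
            rw [toBraidRing_u hv (by grind), Finset.insert_erase hvA, add_mul]
          · have hAW : A ⊆ W := by grind
            refine ⟨(a * h W A, h W A • m), ?_⟩
            simp only [LinearMap.coprod_apply, AlgHom.toLinearMap_apply, map_mul,
              toBraidRing_smul, incl_h _ hAW]
            ring
        · exact ⟨0, by rw [h_eq_zero (Or.inl hA), mul_zero, map_zero]⟩)

theorem splitEquiv_apply {W : Finset α} {v : α} (hv : v ∉ W) (a : BraidRing W)
    (m : FiberModule W) : splitEquiv W hv (a, m) =
      incl (Finset.subset_insert v W) a + toBraidRing W hv m := rfl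

end FiberModule

/-! ### Decomposition of the fiber module into strata. -/

/-- The ideal of the braid ring of `W` that defines the stratum of `L`. -/
noncomputable def stratumIdeal (W L : Finset α) : Ideal (BraidRing W) :=
  Ideal.span {p | ∃ H : Finset α, H ⊆ W ∧ (H ∩ L).Nonempty ∧ ¬ H ⊆ L ∧
    p = h W H - h W (L ∪ H)}

/-- The coordinate ring of the stratum of `L`. -/
abbrev StratumRing (W L : Finset α) : Type := BraidRing W ⧸ stratumIdeal W L

/-- The index set of the strata. -/
abbrev Stratum (W : Finset α) : Type := {L : Finset α // L ⊆ W ∧ 2 ≤ L.card}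

noncomputable instance (W : Finset α) : Fintype (Stratum W) :=
  Fintype.ofInjective (fun L : Stratum W => (⟨L.1, Finset.mem_powerset.2 L.2.1⟩ :
    {L // L ∈ W.powerset})) fun L M hLM => Subtype.ext (by simpa using hLM)

namespace FiberModule

/-- Modulo the ideal, both terms agree with `h_{L ∪ H}`. -/
theorem h_sub_mem_stratumIdeal {W L H G : Finset α} (hH : H ⊆ W) (hG : G ⊆ L) (hL : L ⊆ W)
    (hHG : (H ∩ G).Nonempty) (hHL : ¬ H ⊆ L) : h W H - h W (G ∪ H) ∈ stratumIdeal W L := by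
  have h1 : h W H - h W (L ∪ H) ∈ stratumIdeal W L :=
    Ideal.subset_span ⟨H, hH, hHG.mono (by grind), hHL, rfl⟩
  have h2 : h W (G ∪ H) - h W (L ∪ (G ∪ H)) ∈ stratumIdeal W L :=
    Ideal.subset_span ⟨G ∪ H, by grind, hHG.mono (by grind), by grind, rfl⟩
  have e : L ∪ (G ∪ H) = L ∪ H := by grind
  rw [e] at h2
  have := sub_mem h1 h2
  rwa [sub_sub_sub_cancel_right] at this

open Classical in
/-- The components of an element of the fiber module. -/
noncomputable def toStrata (W : Finset α) :
    FiberModule W →ₗ[BraidRing W] ((L : Stratum W) → StratumRing W L.1) :=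
  lift (g := fun G L => if 2 ≤ G.card ∧ G ⊆ L.1 then 1 else 0)
    { eq_zero := fun G hG => by
        ext L
        rw [Pi.zero_apply, if_neg]
        rintro ⟨h1, h2⟩
        rcases hG with hG | hG
        · exact hG (h2.trans L.2.1)
        · omega
      smul_sub := fun H G hH hG hHG => by
        ext L
        rw [Pi.smul_apply, Pi.sub_apply, Pi.zero_apply]
        by_cases hHL : H ⊆ L.1
        · by_cases hGL : G ⊆ L.1
          · by_cases hG2 : 2 ≤ G.card
            · rw [if_pos ⟨hG2, hGL⟩, if_pos ⟨hG2.trans (Finset.card_le_card (by grind)),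
                by grind⟩, sub_self, smul_zero]
            -- A set `G` with at most one element that meets `H` is contained in `H`.
            · have : G ∪ H = H := by
                obtain ⟨x, hx⟩ := hHG
                have hG1 : G.card ≤ 1 := by omega
                rw [Finset.card_le_one] at hG1
                grind
              rw [this, sub_self, zero_smul]
          · rw [if_neg (by tauto), if_neg (by grind), sub_self, smul_zero]
        · rw [if_neg (c := _ ∧ G ∪ H ⊆ L.1) (by grind)]
          by_cases hGL : G ⊆ L.1
          · rw [sub_zero, ← Submodule.Quotient.mk_out (p := stratumIdeal W L.1) (ite _ _ _),
              ← Submodule.Quotient.mk_smul, Submodule.Quotient.mk_eq_zero, smul_eq_mul]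
            exact Ideal.mul_mem_right _ _ (h_sub_mem_stratumIdeal hH hGL L.2.1 hHG hHL)
          · rw [if_neg (by tauto), sub_self, smul_zero] }

/-- The generator of the component of `L`. -/
noncomputable def w (W L : Finset α) : FiberModule W := mobius W (u W) L

/-- Choose `q ∈ H \ L` and pair the Möbius terms at `K` and `insert q K`. Each difference `u_K -
u_{insert q K}` is already killed by `h_H - h_{L ∪ H}`. Hence the piece generated by `w_L` is a
quotient of `StratumRing W L`. -/
theorem h_sub_smul_w {W L H : Finset α} (hH : H ⊆ W) (hL : L ⊆ W) (hHL : (H ∩ L).Nonempty)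
    (hHL' : ¬ H ⊆ L) : (h W H - h W (L ∪ H)) • w W L = 0 := by
  obtain ⟨q, hqH, hqL⟩ := Finset.not_subset.1 hHL'
  rw [w, mobius_eq_sum_sub _ (hH hqH) hqL, Finset.smul_sum]
  refine Finset.sum_eq_zero fun K hK => ?_
  rw [Finset.mem_Icc] at hK
  have hKW : K ⊆ W := hK.2.trans (Finset.erase_subset _ _)
  have hKH : (H ∩ K).Nonempty := hHL.mono (Finset.inter_subset_inter subset_rfl hK.1)
  rw [smul_comm, smul_sub_of_subset (G := K) hH hKW (by grind) (by grind) hKH (by grind) (by grind)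
    (by grind) (by grind), smul_zero]

/-- The element of the fiber module with given components. -/
noncomputable def ofStrata (W : Finset α) :
    ((L : Stratum W) → StratumRing W L.1) →ₗ[BraidRing W] FiberModule W :=
  ∑ L : Stratum W, ((stratumIdeal W L.1).liftQ
    (LinearMap.toSpanSingleton (BraidRing W) (FiberModule W) (w W L.1)) (by
      rw [stratumIdeal, Ideal.span, Submodule.span_le]
      rintro p ⟨H, hH, hHL, hHL', rfl⟩
      exact h_sub_smul_w hH L.2.1 hHL hHL')).comp (LinearMap.proj L)

theorem ofStrata_apply {W : Finset α} (a : (L : Stratum W) → BraidRing W) :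
    ofStrata W (fun L => Ideal.Quotient.mk _ (a L)) = ∑ L, a L • w W L.1 := by
  rw [ofStrata, LinearMap.sum_apply]
  rfl

theorem sum_stratum {M : Type*} [AddCommMonoid M] {W G : Finset α} (hG2 : 2 ≤ G.card)
    (f : Finset α → M) :
    ∑ L : Stratum W, (if G ⊆ L.1 then f L.1 else 0) = ∑ L ∈ Finset.Icc G W, f L := by
  rw [← Finset.sum_filter]
  refine Finset.sum_bij (fun L _ => L.1) ?_ (fun _ _ _ _ => Subtype.ext) ?_ fun _ _ => rfl
  · intro L hL
    exact Finset.mem_Icc.2 ⟨(Finset.mem_filter.1 hL).2, L.2.1⟩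
  · intro L hL
    rw [Finset.mem_Icc] at hL
    exact ⟨⟨L, hL.2, hG2.trans (Finset.card_le_card hL.1)⟩, by simpa using hL.1, rfl⟩

open Classical in
theorem ofStrata_toStrata {W : Finset α} (m : FiberModule W) : ofStrata W (toStrata W m) = m := by
  have : (ofStrata W).comp (toStrata W) = LinearMap.id := by
    refine linearMap_ext fun G hG hG2 => ?_
    rw [LinearMap.comp_apply, toStrata, lift_u, LinearMap.id_apply]
    have e : (fun L : Stratum W => if 2 ≤ G.card ∧ G ⊆ L.1 then (1 : StratumRing W L.1) else 0) =
        fun L => Ideal.Quotient.mk _ (if G ⊆ L.1 then 1 else 0) := by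
      ext L
      split_ifs <;> simp_all
    rw [e, ofStrata_apply]
    simp only [ite_smul, one_smul, zero_smul]
    rw [sum_stratum hG2]
    exact sum_mobius (u W) hG
  exact DFunLike.congr_fun this m

open Classical in
-- The components of `u_G` are the sum of the unit vectors of all `M ⊇ G`, so Möbius inversion
-- isolates one unit vector.
theorem toStrata_w {W : Finset α} (L : Stratum W) : toStrata W (w W L.1) = Pi.single L 1 := by
  let e : Finset α → ((L : Stratum W) → StratumRing W L.1) := fun M =>
    if hM : M ⊆ W ∧ 2 ≤ M.card then Pi.single ⟨M, hM⟩ 1 else 0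
  have h1 : toStrata W (w W L.1) = mobius W (fun G => ∑ M ∈ Finset.Icc G W, e M) L.1 := by
    rw [w, map_mobius]
    refine mobius_congr fun G hLG hGW => ?_
    have hG2 : 2 ≤ G.card := L.2.2.trans (Finset.card_le_card hLG)
    rw [toStrata, lift_u, ← sum_stratum hG2]
    ext M
    rw [Finset.sum_apply, Finset.sum_eq_single M]
    · by_cases hGM : G ⊆ M.1
      · simp [e, hGM, hG2, M.2.1, M.2.2]
      · simp [hGM]
    · intro N _ hNM
      by_cases hGN : G ⊆ N.1
      · rw [if_pos hGN]
        simp only [e, dif_pos N.2]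
        exact Pi.single_eq_of_ne hNM.symm 1
      · rw [if_neg hGN, Pi.zero_apply]
    · simp
  rw [h1, mobius_sum e L.2.1]
  exact dif_pos L.2

theorem toStrata_ofStrata {W : Finset α} (x : (L : Stratum W) → StratumRing W L.1) :
    toStrata W (ofStrata W x) = x := by
  classical
  obtain ⟨a, rfl⟩ : ∃ a : (L : Stratum W) → BraidRing W,
      x = fun L => Ideal.Quotient.mk _ (a L) :=
    ⟨fun L => (Ideal.Quotient.mk_surjective (x L)).choose,
      funext fun L => (Ideal.Quotient.mk_surjective (x L)).choose_spec.symm⟩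
  rw [ofStrata_apply, map_sum]
  ext L
  simp only [map_smul, toStrata_w, Finset.sum_apply, Pi.smul_apply]
  rw [Finset.sum_eq_single L]
  · rw [Pi.single_eq_same, Algebra.smul_def, mul_one]
    rfl
  · intro M _ hML
    rw [Pi.single_eq_of_ne hML.symm, smul_zero]
  · simp

/-- The decomposition of the fiber module. -/
noncomputable def strataEquiv (W : Finset α) :
    ((L : Stratum W) → StratumRing W L.1) ≃ₗ[BraidRing W] FiberModule W :=
  LinearEquiv.ofLinear (ofStrata W) (toStrata W) (LinearMap.ext ofStrata_toStrata)
    (LinearMap.ext toStrata_ofStrata)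

end FiberModule

/-! ### Each stratum ring is a tensor product of two braid rings. -/

section Stratum

variable {W L : Finset α} {l : α}

open TensorProduct

/-- The map that collapses `L` to the point `l`. -/
def collapse (L : Finset α) (l x : α) : α := if x ∈ L then l else x

theorem image_collapse_of_disjoint {K : Finset α} (hK : Disjoint K L) :
    K.image (collapse L l) = K := by
  rw [Finset.disjoint_left] at hK
  ext x
  simp only [Finset.mem_image, collapse]
  grind

theorem image_collapse_of_meet {K : Finset α} (hK : (K ∩ L).Nonempty) :
    K.image (collapse L l) = insert l (K \ L) := by
  obtain ⟨y, hy⟩ := hK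
  ext x
  simp only [Finset.mem_image, collapse]
  grind

theorem image_collapse_of_subset {K : Finset α} (hl : l ∈ L) (hK : K ⊆ insert l (W \ L)) :
    K.image (collapse L l) = K := by
  ext x
  simp only [Finset.mem_image, collapse]
  grind

/-- If just one of two meeting sets lies in `L`, collapsing `L` gives the union the same image as
the other set, so one factor of the relation is zero. Otherwise the relation is one in a single
tensor factor. -/
theorem isBraidFamily_tmul (hL : L ⊆ W) (hl : l ∈ L) : IsBraidFamily W (fun K =>
    if K ⊆ L then h L K ⊗ₜ[ℚ] (1 : BraidRing (insert l (W \ L)))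
    else (1 : BraidRing L) ⊗ₜ[ℚ] h (insert l (W \ L)) (K.image (collapse L l))) where
  eq_zero K hK := by
    split_ifs with hKL
    · rw [h_eq_zero (hK.imp_left (by grind)), zero_tmul]
    · rw [h_eq_zero, tmul_zero]
      refine hK.imp (fun hKW hc => ?_) (Finset.card_image_le.trans ·)
      obtain ⟨x, hxK, hxW⟩ := Finset.not_subset.1 hKW
      have := hc (Finset.mem_image_of_mem _ hxK)
      simp only [collapse] at this
      grind
  mul_eq_zero A B hA hB hAB := by
    by_cases hAL : A ⊆ L <;> by_cases hBL : B ⊆ L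
    · rw [if_pos hAL, if_pos hBL, if_pos (Finset.union_subset hAL hBL), ← sub_tmul, ← sub_tmul,
        Algebra.TensorProduct.tmul_mul_tmul, (isBraidFamily_h L).mul_eq_zero A B hAL hBL hAB,
        zero_tmul]
    · have e : (A ∪ B).image (collapse L l) = B.image (collapse L l) := by
        rw [image_collapse_of_meet (hAB.mono (by grind)),
          image_collapse_of_meet (hAB.mono (by grind))]
        grind
      rw [if_neg hBL, if_neg (c := A ∪ B ⊆ L) (by grind), e, sub_self, mul_zero]
    · have e : (A ∪ B).image (collapse L l) = A.image (collapse L l) := by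
        rw [image_collapse_of_meet (hAB.mono (by grind)),
          image_collapse_of_meet (hAB.mono (by grind))]
        grind
      rw [if_neg hAL, if_neg (c := A ∪ B ⊆ L) (by grind), e, sub_self, zero_mul]
    · have hsub : ∀ C : Finset α, C ⊆ W → C.image (collapse L l) ⊆ insert l (W \ L) := by
        intro C hC x hx
        simp only [Finset.mem_image, collapse] at hx
        grind
      rw [if_neg hAL, if_neg hBL, if_neg (by grind), ← tmul_sub, ← tmul_sub,
        Algebra.TensorProduct.tmul_mul_tmul, Finset.image_union,
        (isBraidFamily_h _).mul_eq_zero _ _ (hsub A hA) (hsub B hB), tmul_zero]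
      obtain ⟨x, hx⟩ := hAB
      rw [Finset.mem_inter] at hx
      exact ⟨_, Finset.mem_inter.2 ⟨Finset.mem_image_of_mem _ hx.1,
        Finset.mem_image_of_mem _ hx.2⟩⟩

/-- The map from the coordinate ring of a stratum to a tensor product of braid rings. -/
noncomputable def stratumToTensor (hL : L ⊆ W) (hl : l ∈ L) :
    StratumRing W L →ₐ[ℚ] BraidRing L ⊗[ℚ] BraidRing (insert l (W \ L)) :=
  Ideal.Quotient.liftₐ (stratumIdeal W L) (BraidRing.lift (isBraidFamily_tmul hL hl)) (by
    intro a ha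
    have : stratumIdeal W L ≤ RingHom.ker (BraidRing.lift (isBraidFamily_tmul hL hl)) := by
      rw [stratumIdeal, Ideal.span_le]
      rintro _ ⟨H, hH, hHL, hHL', rfl⟩
      have e : (L ∪ H).image (collapse L l) = H.image (collapse L l) := by
        rw [image_collapse_of_meet (hHL.mono (by grind)),
          image_collapse_of_meet hHL]
        grind
      rw [SetLike.mem_coe, RingHom.mem_ker, map_sub, BraidRing.lift_h, BraidRing.lift_h,
        if_neg hHL', if_neg (by grind), e, sub_self]
    exact this ha)

theorem stratumToTensor_mk_h (hL : L ⊆ W) (hl : l ∈ L) (K : Finset α) :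
    stratumToTensor hL hl (Ideal.Quotient.mk _ (h W K)) =
      if K ⊆ L then h L K ⊗ₜ[ℚ] (1 : BraidRing (insert l (W \ L)))
      else (1 : BraidRing L) ⊗ₜ[ℚ] h (insert l (W \ L)) (K.image (collapse L l)) :=
  BraidRing.lift_h (isBraidFamily_tmul hL hl) K

theorem insert_sdiff_subset (hL : L ⊆ W) (hl : l ∈ L) : insert l (W \ L) ⊆ W := by grind

/-- The inverse of `stratumToTensor`. -/
noncomputable def tensorToStratum (hL : L ⊆ W) (hl : l ∈ L) :
    BraidRing L ⊗[ℚ] BraidRing (insert l (W \ L)) →ₐ[ℚ] StratumRing W L :=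
  (Ideal.Quotient.mkₐ ℚ (stratumIdeal W L)).comp
    (Algebra.TensorProduct.productMap (incl hL) (incl (insert_sdiff_subset hL hl)))

theorem tensorToStratum_tmul (hL : L ⊆ W) (hl : l ∈ L) (a : BraidRing L)
    (b : BraidRing (insert l (W \ L))) : tensorToStratum hL hl (a ⊗ₜ b) =
      Ideal.Quotient.mk _ (incl hL a * incl (insert_sdiff_subset hL hl) b) := by
  rw [tensorToStratum, AlgHom.comp_apply, Algebra.TensorProduct.productMap_apply_tmul]
  rfl

/-- The coordinate ring of a stratum is a tensor product of braid rings. -/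
noncomputable def tensorEquiv (hL : L ⊆ W) (hl : l ∈ L) :
    (BraidRing L ⊗[ℚ] BraidRing (insert l (W \ L))) ≃ₐ[ℚ] StratumRing W L :=
  AlgEquiv.ofAlgHom (tensorToStratum hL hl) (stratumToTensor hL hl) (by
    refine Ideal.Quotient.algHom_ext _ (BraidRing.algHom_ext fun K hK _ => ?_)
    change tensorToStratum hL hl (stratumToTensor hL hl (Ideal.Quotient.mk _ (h W K))) =
      Ideal.Quotient.mk _ (h W K)
    rw [stratumToTensor_mk_h]
    split_ifs with hKL
    · rw [tensorToStratum_tmul, map_one, mul_one, incl_h _ hKL]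
    · have hsub : K.image (collapse L l) ⊆ insert l (W \ L) := by
        intro x hx
        simp only [Finset.mem_image, collapse] at hx
        grind
      rw [tensorToStratum_tmul, map_one, one_mul, incl_h _ hsub]
      -- If `K` meets `L`, then `h` of `K` and `h` of its collapse are both congruent to `h_{L ∪
      -- K}`; otherwise collapsing does not change `K`.
      by_cases hKd : (K ∩ L).Nonempty
      · rw [Ideal.Quotient.eq, image_collapse_of_meet hKd]
        have h1 : h W K - h W (L ∪ K) ∈ stratumIdeal W L :=
          Ideal.subset_span ⟨K, hK, hKd, hKL, rfl⟩
        have h2 : h W (insert l (K \ L)) - h W (L ∪ insert l (K \ L)) ∈ stratumIdeal W L :=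
          Ideal.subset_span ⟨_, by grind, ⟨l, by grind⟩, by grind, rfl⟩
        have e : L ∪ insert l (K \ L) = L ∪ K := by grind
        rw [e] at h2
        have := sub_mem h2 h1
        rwa [sub_sub_sub_cancel_right] at this
      · rw [image_collapse_of_disjoint]
        rwa [Finset.disjoint_iff_inter_eq_empty, ← Finset.not_nonempty_iff_eq_empty]) (by
    refine Algebra.TensorProduct.ext (BraidRing.algHom_ext fun K hK _ => ?_)
      (BraidRing.algHom_ext fun K hK hK2 => ?_)
    · change stratumToTensor hL hl (tensorToStratum hL hl (h L K ⊗ₜ 1)) = h L K ⊗ₜ 1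
      rw [tensorToStratum_tmul, map_one, mul_one, incl_h _ hK, stratumToTensor_mk_h, if_pos hK]
    · change stratumToTensor hL hl (tensorToStratum hL hl (1 ⊗ₜ h _ K)) = 1 ⊗ₜ h _ K
      have hKL : ¬ K ⊆ L := fun hKL => by
        have : K ⊆ {l} := by grind
        have := Finset.card_le_card this
        rw [Finset.card_singleton] at this
        omega
      rw [tensorToStratum_tmul, map_one, one_mul, incl_h _ hK, stratumToTensor_mk_h, if_neg hKL,
        image_collapse_of_subset hl hK])

theorem tensorEquiv_tmul (hL : L ⊆ W) (hl : l ∈ L) (a : BraidRing L)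
    (b : BraidRing (insert l (W \ L))) : tensorEquiv hL hl (a ⊗ₜ b) =
      Ideal.Quotient.mk _ (incl hL a * incl (insert_sdiff_subset hL hl) b) :=
  tensorToStratum_tmul hL hl a b

end Stratum
end Splitting

/-! ### Hilbert polynomials of the braid rings. -/

section HilbertPolynomial

variable {α : Type} [DecidableEq α]

open BraidRing FiberModule Polynomial TensorProduct

/-- `p` is the Hilbert polynomial of the braid ring of `V`: there is a basis of homogeneous elements
(that is, of eigenvectors of `scale V`) whose degrees are counted by `p`. -/
def HasHilbertPoly (V : Finset α) (p : ℚ[X]) : Prop :=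
  ∃ (ι : Type) (_ : Fintype ι) (b : Module.Basis ι ℚ (BraidRing V)) (d : ι → ℕ),
    (∀ j, scale V (b j) = (2 : ℚ) ^ d j • b j) ∧ p = ∑ j, X ^ d j

theorem hasHilbertPoly_of_card_le_two {V : Finset α} (hV : V.card ≤ 2) : HasHilbertPoly V 1 := by
  have hfam : IsBraidFamily V (fun _ : Finset α => (0 : ℚ)) :=
    ⟨fun _ _ => rfl, fun _ _ _ _ _ => by simp⟩
  let e : BraidRing V ≃ₐ[ℚ] ℚ := AlgEquiv.ofAlgHom (BraidRing.lift hfam) (Algebra.ofId ℚ _)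
    (by ext) (BraidRing.algHom_ext fun A hA hA2 =>
      absurd (hA2.trans_le (Finset.card_le_card hA)) (by omega))
  refine ⟨Unit, inferInstance, (Module.Basis.singleton Unit ℚ).map e.symm.toLinearEquiv,
    fun _ => 0, fun j => ?_, by simp⟩
  simp

theorem scale_toBraidRing_w {W : Finset α} {v : α} (hv : v ∉ W) {L : Finset α} :
    scale (insert v W) (toBraidRing W hv (w W L)) = (2 : ℚ) • toBraidRing W hv (w W L) := by
  rw [w, map_mobius, map_mobius, mobius, mobius, Finset.smul_sum]
  refine Finset.sum_congr rfl fun K hK => ?_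
  rw [Finset.mem_Icc] at hK
  rw [toBraidRing_u hv hK.2, scale_h, smul_comm]
  congr 1
  rw [Algebra.smul_def, map_ofNat]

theorem exists_mem_of_stratum {W : Finset α} (L : Stratum W) : ∃ l, l ∈ L.1 :=
  Finset.card_pos.1 (lt_of_lt_of_le two_pos L.2.2)

theorem hasHilbertPoly_insert {W : Finset α} {v : α} (hv : v ∉ W) {p : ℚ[X]}
    (hp : HasHilbertPoly W p) {q : ℕ → ℚ[X]}
    (hq : ∀ U : Finset α, U ⊆ W → 1 ≤ U.card → HasHilbertPoly U (q U.card)) :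
    HasHilbertPoly (insert v W)
      (p + X * ∑ L : Stratum W, q L.1.card * q (W.card - L.1.card + 1)) := by
  classical
  choose l hl using exists_mem_of_stratum (W := W)
  have hcard : ∀ L : Stratum W, (insert (l L) (W \ L.1)).card = W.card - L.1.card + 1 := by
    intro L
    rw [Finset.card_insert_of_notMem (by simp [hl]), Finset.card_sdiff_of_subset L.2.1]
  obtain ⟨ι, _, b, d, hb, hpd⟩ := hp
  have h1 : ∀ L : Stratum W, HasHilbertPoly L.1 (q L.1.card) := fun L =>
    hq L.1 L.2.1 (by have := L.2.2; omega)
  have h2 : ∀ L : Stratum W, HasHilbertPoly (insert (l L) (W \ L.1))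
      (q (W.card - L.1.card + 1)) := fun L =>
    hcard L ▸ hq _ (insert_sdiff_subset L.2.1 (hl L)) (by rw [hcard]; omega)
  choose ι₁ _ b₁ d₁ hb₁ hq₁ using h1
  choose ι₂ _ b₂ d₂ hb₂ hq₂ using h2
  let B : Module.Basis ((L : Stratum W) × (ι₁ L × ι₂ L)) ℚ
      ((L : Stratum W) → StratumRing W L.1) :=
    Pi.basis fun L => ((b₁ L).tensorProduct (b₂ L)).map
      (tensorEquiv L.2.1 (hl L)).toLinearEquiv
  refine ⟨ι ⊕ ((L : Stratum W) × (ι₁ L × ι₂ L)), inferInstance,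
    (b.prod (B.map ((strataEquiv W).restrictScalars ℚ))).map (splitEquiv W hv),
    Sum.elim d fun x => d₁ x.1 x.2.1 + d₂ x.1 x.2.2 + 1, ?_, ?_⟩
  · rintro (j | ⟨L, j₁, j₂⟩)
    · rw [Module.Basis.map_apply, Module.Basis.prod_apply]
      change scale _ (splitEquiv W hv (b j, 0)) = 2 ^ d j • splitEquiv W hv (b j, 0)
      rw [splitEquiv_apply, map_zero, add_zero, scale_incl, hb, map_smul]
    · have h3 : (B.map ((strataEquiv W).restrictScalars ℚ)) ⟨L, j₁, j₂⟩ =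
          (incl L.2.1 (b₁ L j₁) * incl (insert_sdiff_subset L.2.1 (hl L)) (b₂ L j₂)) • w W L.1 := by
        rw [Module.Basis.map_apply, Pi.basis_apply, Module.Basis.map_apply,
          Module.Basis.tensorProduct_apply]
        change ofStrata W (Pi.single L (tensorEquiv L.2.1 (hl L) _)) = _
        have h4 : ∀ a : BraidRing W, (Pi.single L (Ideal.Quotient.mk _ a) :
            (L : Stratum W) → StratumRing W L.1) =
              fun M => Ideal.Quotient.mk _ ((Pi.single L a : Stratum W → BraidRing W) M) := by
          intro a
          ext M
          by_cases hM : M = L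
          · subst hM
            simp
          · rw [Pi.single_eq_of_ne hM, Pi.single_eq_of_ne hM, map_zero]
        rw [tensorEquiv_tmul, h4, ofStrata_apply, Finset.sum_eq_single L]
        · rw [Pi.single_eq_same]
        · intro M _ hM
          rw [Pi.single_eq_of_ne hM, zero_smul]
        · simp
      rw [Module.Basis.map_apply, Module.Basis.prod_apply]
      change scale _ (splitEquiv W hv (0, (B.map ((strataEquiv W).restrictScalars ℚ)) ⟨L, j₁, j₂⟩))
        = 2 ^ (d₁ L j₁ + d₂ L j₂ + 1) •
          splitEquiv W hv (0, (B.map ((strataEquiv W).restrictScalars ℚ)) ⟨L, j₁, j₂⟩)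
      rw [h3, splitEquiv_apply, map_zero, zero_add, toBraidRing_smul, map_mul, map_mul, map_mul,
        scale_toBraidRing_w, scale_incl, scale_incl, scale_incl, scale_incl, hb₁, hb₂, map_smul,
        map_smul, map_smul, map_smul]
      simp only [smul_mul_smul_comm]
      congr 1
      ring
  · rw [Fintype.sum_sum_type, Fintype.sum_sigma, hpd]
    simp only [Sum.elim_inl, Sum.elim_inr]
    congr 1
    rw [Finset.mul_sum]
    refine Finset.sum_congr rfl fun L _ => ?_
    rw [hq₁ L, hq₂ L, Finset.sum_mul_sum, ← Fintype.sum_prod_type', Finset.mul_sum]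
    refine Finset.sum_congr rfl fun x _ => ?_
    ring

theorem sum_stratum_card {M : Type*} [AddCommMonoid M] (W : Finset α) (f : ℕ → M) :
    ∑ L : Stratum W, f L.1.card = ∑ j ∈ Finset.Icc 2 W.card, W.card.choose j • f j := by
  have h1 : ∑ L : Stratum W, f L.1.card =
      ∑ L ∈ W.powerset, if 2 ≤ L.card then f L.card else 0 := by
    rw [← Finset.sum_filter]
    refine Finset.sum_bij (fun L _ => L.1) ?_ (fun _ _ _ _ => Subtype.ext) ?_ fun _ _ => rfl
    · intro L _
      exact Finset.mem_filter.2 ⟨Finset.mem_powerset.2 L.2.1, L.2.2⟩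
    · intro L hL
      rw [Finset.mem_filter, Finset.mem_powerset] at hL
      exact ⟨⟨L, hL⟩, Finset.mem_univ _, rfl⟩
  rw [h1, Finset.sum_powerset_apply_card (fun j => if 2 ≤ j then f j else 0)]
  simp only [smul_ite, smul_zero]
  rw [← Finset.sum_filter]
  refine Finset.sum_congr ?_ fun _ _ => rfl
  ext j
  simp only [Finset.mem_filter, Finset.mem_range, Finset.mem_Icc]
  omega

/-- The sequence of polynomials defined by Manin's recursion. -/
noncomputable def maninPoly : ℕ → ℚ[X]
  | 0 => 1
  | 1 => 1
  | n + 2 => maninPoly (n + 1) + X * ∑ j : Fin n,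
      ((n + 1).choose (j + 2) : ℚ[X]) * (maninPoly (j + 2) * maninPoly (n - j))

theorem maninPoly_eq {n : ℕ} (hn : 2 ≤ n) : maninPoly n = maninPoly (n - 1) +
    X * ∑ j ∈ Finset.Icc 2 (n - 1),
      ((n - 1).choose j : ℚ[X]) * (maninPoly j * maninPoly (n - j)) := by
  obtain ⟨n, rfl⟩ := Nat.exists_eq_add_of_le' hn
  rw [maninPoly, Fin.sum_univ_eq_sum_range
    (fun j => ((n + 1).choose (j + 2) : ℚ[X]) * (maninPoly (j + 2) * maninPoly (n - j)))]
  congr 2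
  refine Finset.sum_bij (fun j _ => j + 2) ?_ ?_ ?_ ?_
  · intro j hj
    simp only [Finset.mem_range, Finset.mem_Icc] at hj ⊢
    omega
  · intro i _ j _ h
    omega
  · intro j hj
    simp only [Finset.mem_Icc] at hj
    exact ⟨j - 2, by rw [Finset.mem_range]; omega, by omega⟩
  · intro j _
    rw [Nat.add_sub_add_right]
    rfl

/-- The Hilbert polynomials of the braid rings satisfy Manin's recursion. -/
theorem hasHilbertPoly_maninPoly (V : Finset α) (hV : 1 ≤ V.card) :
    HasHilbertPoly V (maninPoly V.card) := by
  induction hn : V.card using Nat.strong_induction_on generalizing V with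
  | _ n ih =>
    subst hn
    rcases hV.eq_or_lt with h1 | h2
    · rw [← h1, maninPoly]
      exact hasHilbertPoly_of_card_le_two (by omega)
    · obtain ⟨v, hv⟩ : V.Nonempty := Finset.card_pos.1 hV
      -- Removing any vertex `v` leaves `W` with `|V| - 1` elements; collapsing a set of size `j` in
      -- it leaves `|V| - j`.
      have hcard : (V.erase v).card = V.card - 1 := Finset.card_erase_of_mem hv
      have h3 := hasHilbertPoly_insert (Finset.notMem_erase v V)
        (ih (V.erase v).card (by omega) (V.erase v) (by omega) rfl) (q := maninPoly)
        fun U hU hU1 => ih U.card (by have := Finset.card_le_card hU; omega) U hU1 rfl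
      rw [Finset.insert_erase hv] at h3
      rw [maninPoly_eq h2]
      convert h3 using 2
      · rw [hcard]
      · rw [sum_stratum_card (V.erase v)
          (fun j => maninPoly j * maninPoly ((V.erase v).card - j + 1)), hcard]
        congr 1
        refine Finset.sum_congr rfl fun j hj => ?_
        rw [Finset.mem_Icc] at hj
        rw [nsmul_eq_mul, show V.card - j = V.card - 1 - j + 1 by omega]

end HilbertPolynomial

/-! ### Flats, ranks and the minimal building set of the braid matroid. -/

section BraidMatroid

variable {n : ℕ}

theorem braidMatroid_indep_iff {I : Set (Sym2 (Fin n))} :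
    (braidMatroid n).Indep I ↔
      (∀ e ∈ I, ¬ e.IsDiag) ∧ (SimpleGraph.fromEdgeSet I).IsAcyclic := by
  have h : (braidMatroid n).Indep I ↔ IsForestIn ⊤ I := Iff.rfl
  rw [h, IsForestIn, SimpleGraph.edgeSet_top]
  rfl

theorem braidMatroid_ground : (braidMatroid n).E = {e | ¬ e.IsDiag} := by
  rw [braidMatroid, graphicMatroid]
  exact SimpleGraph.edgeSet_top

theorem reachable_of_adj_imp {V : Type*} {G H : SimpleGraph V}
    (hGH : ∀ x y, G.Adj x y → H.Reachable x y) {x y : V} (hxy : G.Reachable x y) :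
    H.Reachable x y := by
  obtain ⟨p⟩ := hxy
  induction p with
  | nil => exact SimpleGraph.Reachable.refl _
  | cons h _ ih => exact (hGH _ _ h).trans ih

/-- Adding a new edge to a forest creates a cycle exactly when its endpoints are already connected.
-/
theorem mem_closure_iff_reachable_of_indep {I : Set (Sym2 (Fin n))} (hI : (braidMatroid n).Indep I)
    {i j : Fin n} (hij : i ≠ j) : s(i, j) ∈ (braidMatroid n).closure I ↔
      (SimpleGraph.fromEdgeSet I).Reachable i j := by
  by_cases hmem : s(i, j) ∈ I
  · exact ⟨fun _ => SimpleGraph.Adj.reachable ((SimpleGraph.fromEdgeSet_adj _).2 ⟨hmem, hij⟩),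
      fun _ => (braidMatroid n).subset_closure I hI.subset_ground hmem⟩
  · rw [hI.mem_closure_iff_of_notMem hmem, Matroid.dep_iff, braidMatroid_indep_iff,
      braidMatroid_ground]
    have h1 : ∀ e ∈ insert s(i, j) I, ¬ e.IsDiag := by
      rintro e (rfl | he)
      · simpa using hij
      · exact (braidMatroid_indep_iff.1 hI).1 e he
    have h2 : SimpleGraph.fromEdgeSet (insert s(i, j) I) =
        SimpleGraph.fromEdgeSet I ⊔ SimpleGraph.edge i j := by
      rw [SimpleGraph.edge, ← SimpleGraph.fromEdgeSet_union, Set.union_singleton]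
    rw [and_iff_left (by exact h1), not_and, h2, SimpleGraph.isAcyclic_sup_fromEdgeSet_iff]
    have h3 := (braidMatroid_indep_iff.1 hI).2
    have h4 : ¬ (SimpleGraph.fromEdgeSet I).Adj i j := by
      rw [SimpleGraph.fromEdgeSet_adj]
      tauto
    tauto

theorem mem_closure_iff_reachable {X : Set (Sym2 (Fin n))} (hX : ∀ e ∈ X, ¬ e.IsDiag)
    {i j : Fin n} (hij : i ≠ j) : s(i, j) ∈ (braidMatroid n).closure X ↔
      (SimpleGraph.fromEdgeSet X).Reachable i j := by
  have hXE : X ⊆ (braidMatroid n).E := by rw [braidMatroid_ground]; exact hX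
  obtain ⟨I, hI⟩ := (braidMatroid n).exists_isBasis X hXE
  rw [← hI.closure_eq_closure, mem_closure_iff_reachable_of_indep hI.indep hij]
  refine ⟨fun h => h.mono (SimpleGraph.fromEdgeSet_mono hI.subset), fun h =>
    reachable_of_adj_imp (fun x y hxy => ?_) h⟩
  rw [SimpleGraph.fromEdgeSet_adj] at hxy
  rw [← mem_closure_iff_reachable_of_indep hI.indep hxy.2, hI.closure_eq_closure]
  exact (braidMatroid n).subset_closure X hXE hxy.1

/-- A set of edges is closed if it contains the third edge of a triangle with each two. -/
def IsTriangleClosed (F : Set (Sym2 (Fin n))) : Prop :=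
  (∀ e ∈ F, ¬ e.IsDiag) ∧ ∀ x y z, s(x, y) ∈ F → s(y, z) ∈ F → x ≠ z → s(x, z) ∈ F

/-- A walk in a triangle-closed set can be shortened edge by edge to a single edge, so connectivity
by edges of `F` is the same as adjacency. -/
theorem isFlat_iff_isTriangleClosed {F : Set (Sym2 (Fin n))} :
    (braidMatroid n).IsFlat F ↔ IsTriangleClosed F := by
  constructor
  · intro hF
    have hd : ∀ e ∈ F, ¬ e.IsDiag := fun e he => by
      have := hF.subset_ground he
      rwa [braidMatroid_ground] at this
    refine ⟨hd, fun x y z hxy hyz hxz => ?_⟩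
    rw [← hF.closure, mem_closure_iff_reachable hd hxz]
    have h1 : (SimpleGraph.fromEdgeSet F).Adj x y :=
      (SimpleGraph.fromEdgeSet_adj _).2 ⟨hxy, by simpa using hd _ hxy⟩
    have h2 : (SimpleGraph.fromEdgeSet F).Adj y z :=
      (SimpleGraph.fromEdgeSet_adj _).2 ⟨hyz, by simpa using hd _ hyz⟩
    exact h1.reachable.trans h2.reachable
  · intro hF
    rw [Matroid.isFlat_iff_closure_eq]
    refine Set.Subset.antisymm (fun e => ?_) ((braidMatroid n).subset_closure F
      (by rw [braidMatroid_ground]; exact hF.1))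
    induction e using Sym2.ind with
    | _ i j =>
      intro he
      have hij : i ≠ j := by
        have := (braidMatroid n).closure_subset_ground F he
        rw [braidMatroid_ground] at this
        simpa using this
      rw [mem_closure_iff_reachable hF.1 hij] at he
      obtain ⟨p⟩ := he
      have key : ∀ i j, (SimpleGraph.fromEdgeSet F).Walk i j → i = j ∨ s(i, j) ∈ F := by
        intro i j p
        induction p with
        | nil => exact Or.inl rfl
        | cons h _ ih =>
          rw [SimpleGraph.fromEdgeSet_adj] at h
          rcases ih with rfl | ih
          · exact Or.inr h.1
          · exact or_iff_not_imp_left.2 fun hne => hF.2 _ _ _ h.1 ih hne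
      exact (key i j p).resolve_left hij

/-- The edges between the elements of `A`. -/
def cliqueEdges (A : Finset (Fin n)) : Set (Sym2 (Fin n)) := {e | ¬ e.IsDiag ∧ ∀ x ∈ e, x ∈ A}

theorem mk_mem_cliqueEdges {A : Finset (Fin n)} {x y : Fin n} :
    s(x, y) ∈ cliqueEdges A ↔ x ≠ y ∧ x ∈ A ∧ y ∈ A := by
  simp [cliqueEdges]

theorem isFlat_cliqueEdges (A : Finset (Fin n)) : (braidMatroid n).IsFlat (cliqueEdges A) := by
  rw [isFlat_iff_isTriangleClosed]
  refine ⟨fun e he => he.1, fun x y z hxy hyz hxz => ?_⟩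
  rw [mk_mem_cliqueEdges] at *
  tauto

theorem cliqueEdges_subset_iff {A B : Finset (Fin n)} (hA : 2 ≤ A.card) :
    cliqueEdges A ⊆ cliqueEdges B ↔ A ⊆ B := by
  constructor
  · intro h x hx
    obtain ⟨y, hy, hyx⟩ := Finset.exists_mem_ne hA x
    exact (mk_mem_cliqueEdges.1 (h (mk_mem_cliqueEdges.2 ⟨hyx.symm, hx, hy⟩))).2.1
  · exact fun h e he => ⟨he.1, fun x hx => h (he.2 x hx)⟩

/-- The edges that connect `a` to the other elements of `A`. -/
def starEdges (a : Fin n) (A : Finset (Fin n)) : Set (Sym2 (Fin n)) :=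
  (fun b => s(a, b)) '' (A.erase a : Finset (Fin n))

theorem encard_starEdges {a : Fin n} {A : Finset (Fin n)} (ha : a ∈ A) :
    (starEdges a A).encard = (A.card - 1 : ℕ) := by
  rw [starEdges, Set.InjOn.encard_image, Set.encard_coe_eq_coe_finsetCard,
    Finset.card_erase_of_mem ha]
  intro x _ y _ hxy
  exact Sym2.congr_right.1 hxy

theorem indep_starEdges (a : Fin n) (A : Finset (Fin n)) :
    (braidMatroid n).Indep (starEdges a A) := by
  rw [braidMatroid_indep_iff]
  constructor
  · rintro _ ⟨b, hb, rfl⟩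
    simp only [Finset.coe_erase, Set.mem_sdiff, Set.mem_singleton_iff] at hb
    simpa using Ne.symm hb.2
  · refine (SimpleGraph.isTree_starGraph a).isAcyclic.anti fun x y hxy => ?_
    rw [SimpleGraph.fromEdgeSet_adj] at hxy
    obtain ⟨⟨b, -, hb⟩, hne⟩ := hxy
    rw [SimpleGraph.starGraph_adj]
    refine ⟨hne, ?_⟩
    rw [Sym2.eq_iff] at hb
    tauto

/-- The star at `a` is a spanning tree of the clique; it provides the rank `|A| - 1`. -/
theorem closure_starEdges {a : Fin n} {A : Finset (Fin n)} (ha : a ∈ A) :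
    (braidMatroid n).closure (starEdges a A) = cliqueEdges A := by
  have hsub : starEdges a A ⊆ cliqueEdges A := by
    rintro _ ⟨b, hb, rfl⟩
    simp only [Finset.coe_erase, Set.mem_sdiff, Set.mem_singleton_iff, Finset.mem_coe] at hb
    exact mk_mem_cliqueEdges.2 ⟨Ne.symm hb.2, ha, hb.1⟩
  refine Set.Subset.antisymm ?_ ?_
  · rw [← (isFlat_cliqueEdges A).closure]
    exact (braidMatroid n).closure_subset_closure hsub
  · intro e
    induction e using Sym2.ind with
    | _ x y =>
      rw [mk_mem_cliqueEdges]
      rintro ⟨hxy, hx, hy⟩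
      rw [mem_closure_iff_reachable_of_indep (indep_starEdges a A) hxy]
      have key : ∀ z ∈ A, (SimpleGraph.fromEdgeSet (starEdges a A)).Reachable a z := by
        intro z hz
        by_cases haz : a = z
        · exact haz ▸ SimpleGraph.Reachable.refl _
        · exact SimpleGraph.Adj.reachable ((SimpleGraph.fromEdgeSet_adj _).2
            ⟨⟨z, by simpa using ⟨hz, Ne.symm haz⟩, rfl⟩, haz⟩)
      exact (key x hx).symm.trans (key y hy)

theorem eRk_cliqueEdges {A : Finset (Fin n)} (hA : A.Nonempty) :
    (braidMatroid n).eRk (cliqueEdges A) = (A.card - 1 : ℕ) := by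
  obtain ⟨a, ha⟩ := hA
  rw [← closure_starEdges ha, Matroid.eRk_closure_eq, (indep_starEdges a A).eRk_eq_encard,
    encard_starEdges ha]

theorem cliqueEdges_union_subset_closure {A B : Finset (Fin n)} (hAB : (A ∩ B).Nonempty) :
    cliqueEdges (A ∪ B) ⊆ (braidMatroid n).closure (cliqueEdges A ∪ cliqueEdges B) := by
  obtain ⟨a, ha⟩ := hAB
  rw [Finset.mem_inter] at ha
  rw [← closure_starEdges (Finset.mem_union_left B ha.1)]
  refine (braidMatroid n).closure_subset_closure ?_
  rintro _ ⟨b, hb, rfl⟩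
  simp only [Finset.coe_erase, Finset.coe_union, Set.mem_sdiff, Set.mem_union, Finset.mem_coe,
    Set.mem_singleton_iff] at hb
  rw [Set.mem_union, mk_mem_cliqueEdges, mk_mem_cliqueEdges]
  tauto

theorem isFlat_restrict_iff {α : Type*} {M : Matroid α} {F X : Set α} (hF : M.IsFlat F) :
    (M.restrict F).IsFlat X ↔ M.IsFlat X ∧ X ⊆ F := by
  constructor
  · intro hX
    have hXF : X ⊆ F := hX.subset_ground
    have h1 := hX.closure
    rw [Matroid.restrict_closure_eq M hXF hF.subset_ground] at h1
    refine ⟨?_, hXF⟩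
    rw [Matroid.isFlat_iff_closure_eq]
    rwa [Set.inter_eq_left.2 (hF.closure ▸ M.closure_subset_closure hXF)] at h1
  · rintro ⟨hX, hXF⟩
    rw [Matroid.isFlat_iff_closure_eq, Matroid.restrict_closure_eq M hXF hF.subset_ground,
      hX.closure, Set.inter_eq_left]
    exact hXF

/-- A product decomposition yields complementary flats `X` and `Y`, and every edge, being an atom,
lies in exactly one of them. In a triangle two edges lie in the same flat, which then contains the
third; hence all edges lie in one flat, and one factor is trivial. -/
theorem isConnectedMatroid_cliqueEdges {A : Finset (Fin n)} (hA : 2 ≤ A.card) :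
    IsConnectedMatroid ((braidMatroid n).restrict (cliqueEdges A)) := by
  intro P Q _ _ ⟨e⟩
  have hflat := fun X => isFlat_restrict_iff (X := X) (isFlat_cliqueEdges A)
  let bot : FlatLattice ((braidMatroid n).restrict (cliqueEdges A)) :=
    ⟨∅, (hflat _).2 ⟨isFlat_iff_isTriangleClosed.2 ⟨by simp, by simp⟩, Set.empty_subset _⟩⟩
  let top : FlatLattice ((braidMatroid n).restrict (cliqueEdges A)) :=
    ⟨cliqueEdges A, (hflat _).2 ⟨isFlat_cliqueEdges A, subset_rfl⟩⟩
  have hbot : ∀ X, bot ≤ X := fun X => Set.empty_subset X.1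
  have htop : ∀ X, X ≤ top := fun X => ((hflat _).1 X.2).2
  have hbot' : ∀ p q, e bot ≤ (p, q) := fun p q => by
    rw [← e.le_symm_apply]; exact hbot _
  have htop' : ∀ p q, (p, q) ≤ e top := fun p q => by
    rw [← e.symm_apply_le]; exact htop _
  let X := e.symm ((e top).1, (e bot).2)
  let Y := e.symm ((e bot).1, (e top).2)
  have hatom : ∀ s ∈ cliqueEdges A, (s ∈ X.1 ∨ s ∈ Y.1) ∧ ¬ (s ∈ X.1 ∧ s ∈ Y.1) := by
    intro s hs
    let a : FlatLattice ((braidMatroid n).restrict (cliqueEdges A)) :=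
      ⟨{s}, (hflat _).2 ⟨isFlat_iff_isTriangleClosed.2 ⟨fun t ht => ht ▸ hs.1, by
        intro x y z hxy hyz hxz
        rw [Set.mem_singleton_iff] at hxy hyz
        rw [← hyz, Sym2.eq_swap, Sym2.congr_right] at hxy
        exact absurd hxy hxz⟩, Set.singleton_subset_iff.2 hs⟩⟩
    have hle : ∀ Z : FlatLattice ((braidMatroid n).restrict (cliqueEdges A)),
        s ∈ Z.1 ↔ a ≤ Z := fun Z => Set.singleton_subset_iff.symm
    rw [hle, hle, e.le_symm_apply, e.le_symm_apply]
    constructor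
    -- The part of the atom in the first factor lies below the atom, so it is either bottom or the
    -- atom itself.
    · have h1 : e.symm ((e a).1, (e bot).2) ≤ a := by
        rw [e.symm_apply_le]
        exact ⟨le_rfl, (hbot' (e a).1 (e a).2).2⟩
      rcases Set.subset_singleton_iff_eq.1 (show (e.symm ((e a).1, (e bot).2)).1 ⊆ {s} from h1)
        with h2 | h2
      · right
        have h3 : e.symm ((e a).1, (e bot).2) = bot := Subtype.ext h2
        rw [e.symm_apply_eq] at h3
        exact ⟨(congrArg Prod.fst h3).le, (htop' (e a).1 (e a).2).2⟩
      · left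
        have h3 : e.symm ((e a).1, (e bot).2) = a := Subtype.ext h2
        rw [e.symm_apply_eq] at h3
        exact ⟨(htop' (e a).1 (e a).2).1, (congrArg Prod.snd h3).ge⟩
    · rintro ⟨h1, h2⟩
      have h3 : e a ≤ e bot := ⟨h2.1, h1.2⟩
      rw [e.le_iff_le] at h3
      exact h3 (Set.mem_singleton s)
  have htri : ∀ Z : FlatLattice ((braidMatroid n).restrict (cliqueEdges A)),
      IsTriangleClosed Z.1 := fun Z => isFlat_iff_isTriangleClosed.1 ((hflat _).1 Z.2).1
  have key : ∀ Z Z' : FlatLattice ((braidMatroid n).restrict (cliqueEdges A)),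
      (∀ s ∈ cliqueEdges A, (s ∈ Z.1 ∨ s ∈ Z'.1) ∧ ¬ (s ∈ Z.1 ∧ s ∈ Z'.1)) →
      ∀ a b, a ≠ b → a ∈ A → b ∈ A → s(a, b) ∈ Z.1 → Z = top := by
    intro Z Z' hZZ' a b hab ha hb habZ
    have h1 : ∀ c ∈ A, a ≠ c → s(a, c) ∈ Z.1 := by
      intro c hc hac
      by_contra hcon
      have hacZ' := (hZZ' _ (mk_mem_cliqueEdges.2 ⟨hac, ha, hc⟩)).1.resolve_left hcon
      have hbc : b ≠ c := fun h => hcon (h ▸ habZ)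
      rcases (hZZ' _ (mk_mem_cliqueEdges.2 ⟨hbc, hb, hc⟩)).1 with h2 | h2
      · exact hcon ((htri Z).2 a b c habZ h2 hac)
      · rw [Sym2.eq_swap] at h2
        exact (hZZ' _ (mk_mem_cliqueEdges.2 ⟨hab, ha, hb⟩)).2
          ⟨habZ, (htri Z').2 a c b hacZ' h2 hab⟩
    refine le_antisymm (htop Z) fun s => ?_
    induction s using Sym2.ind with
    | _ x y =>
      intro hxy
      obtain ⟨hne, hx, hy⟩ := mk_mem_cliqueEdges.1 hxy
      by_cases hax : a = x
      · subst hax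
        exact h1 y hy hne
      · by_cases hay : a = y
        · subst hay
          rw [Sym2.eq_swap]
          exact h1 x hx hax
        · have h2 := h1 x hx hax
          rw [Sym2.eq_swap] at h2
          exact (htri Z).2 x a y h2 (h1 y hy hay) hne
  obtain ⟨a, ha, b, hb, hab⟩ := Finset.one_lt_card.1 hA
  rcases (hatom _ (mk_mem_cliqueEdges.2 ⟨hab, ha, hb⟩)).1 with h1 | h1
  · right
    have h2 : X = top := key X Y hatom a b hab ha hb h1
    have h3 : ((e top).1, (e bot).2) = e top := (e.symm_apply_eq).1 h2
    replace h3 := congrArg Prod.snd h3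
    change (e bot).2 = (e top).2 at h3
    refine ⟨fun q q' => ?_⟩
    have h4 : ∀ q : Q, q = (e bot).2 := fun q =>
      le_antisymm (h3 ▸ (htop' (e bot).1 q).2) (hbot' (e bot).1 q).2
    rw [h4 q, h4 q']
  · left
    have h2 : Y = top := key Y X (fun s hs => by
      have := hatom s hs
      tauto) a b hab ha hb h1
    have h3 : ((e bot).1, (e top).2) = e top := (e.symm_apply_eq).1 h2
    replace h3 := congrArg Prod.fst h3
    change (e bot).1 = (e top).1 at h3
    refine ⟨fun q q' => ?_⟩
    have h4 : ∀ q : P, q = (e bot).1 := fun q =>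
      le_antisymm (h3 ▸ (htop' q (e bot).2).1) (hbot' q (e bot).2).1
    rw [h4 q, h4 q']

open Classical in
/-- The block of `a` in the partition given by a closed set of edges. -/
noncomputable def edgeBlock (F : Set (Sym2 (Fin n))) (a : Fin n) : Finset (Fin n) :=
  Finset.univ.filter fun x => x = a ∨ s(a, x) ∈ F

theorem mem_edgeBlock {F : Set (Sym2 (Fin n))} {a x : Fin n} :
    x ∈ edgeBlock F a ↔ x = a ∨ s(a, x) ∈ F := by
  simp [edgeBlock]

theorem cliqueEdges_edgeBlock_subset {F : Set (Sym2 (Fin n))} (hF : IsTriangleClosed F)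
    (a : Fin n) : cliqueEdges (edgeBlock F a) ⊆ F := by
  intro e
  induction e using Sym2.ind with
  | _ x y =>
    rw [mk_mem_cliqueEdges, mem_edgeBlock, mem_edgeBlock]
    rintro ⟨hxy, rfl | hx, rfl | hy⟩
    · exact absurd rfl hxy
    · exact hy
    · rwa [Sym2.eq_swap]
    · rw [Sym2.eq_swap] at hx
      exact hF.2 x a y hx hy hxy

theorem mem_edgeBlock_of_mem {F : Set (Sym2 (Fin n))} (hF : IsTriangleClosed F) {a x y : Fin n}
    (hx : x ∈ edgeBlock F a) (hxy : s(x, y) ∈ F) : y ∈ edgeBlock F a := by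
  rw [mem_edgeBlock] at *
  rcases hx with rfl | hx
  · exact Or.inr hxy
  · exact or_iff_not_imp_left.2 fun hya => hF.2 a x y hx hxy (Ne.symm hya)

theorem isTriangleClosed_sdiff {F : Set (Sym2 (Fin n))} (hF : IsTriangleClosed F) (a : Fin n) :
    IsTriangleClosed (F \ cliqueEdges (edgeBlock F a)) := by
  refine ⟨fun e he => hF.1 e he.1, fun x y z hxy hyz hxz =>
    ⟨hF.2 x y z hxy.1 hyz.1 hxz, fun h => hxy.2 ?_⟩⟩
  rw [mk_mem_cliqueEdges] at h ⊢
  exact ⟨by simpa using hF.1 _ hxy.1, h.2.1, mem_edgeBlock_of_mem hF h.2.1 hxy.1⟩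

theorem IsTriangleClosed.inter {F G : Set (Sym2 (Fin n))} (hF : IsTriangleClosed F)
    (hG : IsTriangleClosed G) : IsTriangleClosed (F ∩ G) :=
  ⟨fun e he => hF.1 e he.1, fun x y z hxy hyz hxz =>
    ⟨hF.2 x y z hxy.1 hyz.1 hxz, hG.2 x y z hxy.2 hyz.2 hxz⟩⟩

/-- An edge inside the block of `a` never shares a vertex with an edge of `F` outside it, so no
triangle mixes `X` and `Y`. -/
theorem IsTriangleClosed.union {F X Y : Set (Sym2 (Fin n))} (hF : IsTriangleClosed F)
    {a : Fin n} (hX : IsTriangleClosed X) (hY : IsTriangleClosed Y)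
    (hXF : X ⊆ cliqueEdges (edgeBlock F a)) (hYF : Y ⊆ F \ cliqueEdges (edgeBlock F a)) :
    IsTriangleClosed (X ∪ Y) := by
  have key : ∀ x y z, s(x, y) ∈ X → s(y, z) ∈ Y → False := by
    intro x y z hxy hyz
    refine (hYF hyz).2 (mk_mem_cliqueEdges.2 ⟨by simpa using hY.1 _ hyz, ?_, ?_⟩)
    · exact (mk_mem_cliqueEdges.1 (hXF hxy)).2.2
    · exact mem_edgeBlock_of_mem hF (mk_mem_cliqueEdges.1 (hXF hxy)).2.2 (hYF hyz).1
  refine ⟨fun e he => he.elim (hX.1 e) (hY.1 e), fun x y z hxy hyz hxz => ?_⟩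
  rcases hxy with hxy | hxy <;> rcases hyz with hyz | hyz
  · exact Or.inl (hX.2 x y z hxy hyz hxz)
  · exact (key x y z hxy hyz).elim
  · rw [Sym2.eq_swap] at hxy hyz
    exact (key z y x hyz hxy).elim
  · exact Or.inr (hY.2 x y z hxy hyz hxz)

/-- The decomposition of the lattice of flats that is given by a block. -/
noncomputable def flatLatticeEquiv {F : Set (Sym2 (Fin n))} (hF : IsTriangleClosed F) (a : Fin n) :
    FlatLattice ((braidMatroid n).restrict F) ≃o
      {X : Set (Sym2 (Fin n)) // IsTriangleClosed X ∧ X ⊆ cliqueEdges (edgeBlock F a)} ×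
      {X : Set (Sym2 (Fin n)) // IsTriangleClosed X ∧ X ⊆ F \ cliqueEdges (edgeBlock F a)} where
  toFun X := by
    have hX := (isFlat_restrict_iff (isFlat_iff_isTriangleClosed.2 hF)).1 X.2
    have hX1 := isFlat_iff_isTriangleClosed.1 hX.1
    exact (⟨X.1 ∩ cliqueEdges (edgeBlock F a), hX1.inter
        (isFlat_iff_isTriangleClosed.1 (isFlat_cliqueEdges _)), Set.inter_subset_right⟩,
      ⟨X.1 ∩ (F \ cliqueEdges (edgeBlock F a)), hX1.inter (isTriangleClosed_sdiff hF a),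
        Set.inter_subset_right⟩)
  invFun Y := ⟨Y.1.1 ∪ Y.2.1, (isFlat_restrict_iff (isFlat_iff_isTriangleClosed.2 hF)).2
    ⟨isFlat_iff_isTriangleClosed.2 (hF.union Y.1.2.1 Y.2.2.1 Y.1.2.2 Y.2.2.2),
      Set.union_subset (Y.1.2.2.trans (cliqueEdges_edgeBlock_subset hF a))
        (Y.2.2.2.trans Set.sdiff_subset)⟩⟩
  left_inv X := by
    have hX := (isFlat_restrict_iff (isFlat_iff_isTriangleClosed.2 hF)).1 X.2
    refine Subtype.ext ?_
    ext e
    have := @hX.2 e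
    simp only [Set.mem_union, Set.mem_inter_iff, Set.mem_sdiff]
    tauto
  right_inv Y := by
    refine Prod.ext (Subtype.ext ?_) (Subtype.ext ?_) <;> ext e <;>
      have h1 := @Y.1.2.2 e <;> have h2 := @Y.2.2.2 e <;>
      simp only [Set.mem_union, Set.mem_inter_iff, Set.mem_sdiff] at h2 ⊢ <;> tauto
  map_rel_iff' := by
    intro X Y
    have hX := (isFlat_restrict_iff (isFlat_iff_isTriangleClosed.2 hF)).1 X.2
    constructor
    · rintro ⟨h1, h2⟩ e he
      by_cases hec : e ∈ cliqueEdges (edgeBlock F a)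
      · exact (h1 ⟨he, hec⟩).1
      · exact (h2 ⟨he, hX.2 he, hec⟩).1
    · exact fun h => ⟨Set.inter_subset_inter_left _ h, Set.inter_subset_inter_left _ h⟩

theorem isTriangleClosed_empty : IsTriangleClosed (∅ : Set (Sym2 (Fin n))) := ⟨by simp, by simp⟩

/-- For a vertex `a` of an edge of `F`, the lattice of flats below `F` is a product over the block
of `a` and the remaining edges. The block contains an edge, so connectedness forces the remainder to
be empty. -/
theorem mem_minimalBuildingSet_iff {F : Set (Sym2 (Fin n))} :
    F ∈ minimalBuildingSet (braidMatroid n) ↔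
      ∃ A : Finset (Fin n), 2 ≤ A.card ∧ F = cliqueEdges A := by
  constructor
  · rintro ⟨hF, ⟨e, he⟩, hconn⟩
    rw [isFlat_iff_isTriangleClosed] at hF
    induction e using Sym2.ind with
    | _ a b =>
      have hab : a ≠ b := by simpa using hF.1 _ he
      have ha : a ∈ edgeBlock F a := mem_edgeBlock.2 (Or.inl rfl)
      have hb : b ∈ edgeBlock F a := mem_edgeBlock.2 (Or.inr he)
      refine ⟨edgeBlock F a, Finset.one_lt_card.2 ⟨a, ha, b, hb, hab⟩, ?_⟩
      rcases hconn _ _ ⟨flatLatticeEquiv hF a⟩ with h | h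
      · have h1 := congrArg Subtype.val (h.elim ⟨∅, isTriangleClosed_empty, Set.empty_subset _⟩
          ⟨cliqueEdges (edgeBlock F a), isFlat_iff_isTriangleClosed.1 (isFlat_cliqueEdges _),
            subset_rfl⟩)
        have h2 : s(a, b) ∈ cliqueEdges (edgeBlock F a) := mk_mem_cliqueEdges.2 ⟨hab, ha, hb⟩
        change ∅ = cliqueEdges (edgeBlock F a) at h1
        rw [← h1] at h2
        exact h2.elim
      · have h1 := congrArg Subtype.val (h.elim ⟨∅, isTriangleClosed_empty, Set.empty_subset _⟩
          ⟨F \ cliqueEdges (edgeBlock F a), isTriangleClosed_sdiff hF a, subset_rfl⟩)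
        change ∅ = F \ cliqueEdges (edgeBlock F a) at h1
        exact (Set.sdiff_eq_empty.1 h1.symm).antisymm (cliqueEdges_edgeBlock_subset hF a)
  · rintro ⟨A, hA, rfl⟩
    obtain ⟨a, ha, b, hb, hab⟩ := Finset.one_lt_card.1 hA
    exact ⟨isFlat_cliqueEdges A, ⟨s(a, b), mk_mem_cliqueEdges.2 ⟨hab, ha, hb⟩⟩,
      isConnectedMatroid_cliqueEdges hA⟩

end BraidMatroid

/-! ### The Möbius transforms `xi` and the products that vanish. -/

section BoundaryClasses

variable {α : Type} [DecidableEq α]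

namespace BraidRing

/-- The Möbius transform of the generators of the braid ring. -/
noncomputable def xi (V A : Finset α) : BraidRing V := mobius V (h V) A

theorem sum_xi {V A : Finset α} (hA : A ⊆ V) : ∑ K ∈ Finset.Icc A V, xi V K = h V A :=
  sum_mobius (h V) hA

theorem scale_xi (V A : Finset α) : scale V (xi V A) = 2 * xi V A := by
  rw [xi, map_mobius, mobius, mobius, Finset.mul_sum]
  refine Finset.sum_congr rfl fun K _ => ?_
  rw [scale_h, mul_smul_comm]

/-- Pair the Möbius terms at `G` and `insert q G` with `q ∈ K \ A`. All unions that occur equal `G ∪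
K`, and four braid relations combine to zero. -/
theorem xi_mul_h {V A K : Finset α} (hA : A ⊆ V) (hK : K ⊆ V) (hKA : (K ∩ A).Nonempty)
    (hKA' : ¬ K ⊆ A) : xi V A * h V K = xi V A * h V (A ∪ K) := by
  obtain ⟨q, hqK, hqA⟩ := Finset.not_subset.1 hKA'
  rw [← sub_eq_zero, ← mul_sub, xi, mobius_eq_sum_sub _ (hK hqK) hqA, Finset.sum_mul]
  refine Finset.sum_eq_zero fun G hG => ?_
  rw [Finset.mem_Icc] at hG
  have hGV : G ⊆ V := hG.2.trans (Finset.erase_subset _ _)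
  have hKG : (G ∩ K).Nonempty := hKA.mono (by
    rw [Finset.inter_comm]
    exact Finset.inter_subset_inter hG.1 subset_rfl)
  obtain ⟨x, hx⟩ := hKG
  have hAG := hG.1
  have e1 : insert q G ∪ K = G ∪ K := by grind
  have e2 : G ∪ (A ∪ K) = G ∪ K := by grind
  have e3 : insert q G ∪ (A ∪ K) = G ∪ K := by grind
  have h1 := (isBraidFamily_h V).mul_eq_zero G K hGV hK ⟨x, hx⟩
  have h2 := (isBraidFamily_h V).mul_eq_zero (insert q G) K (by grind) hK ⟨x, by grind⟩
  have h3 := (isBraidFamily_h V).mul_eq_zero G (A ∪ K) hGV (by grind) ⟨x, by grind⟩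
  have h4 := (isBraidFamily_h V).mul_eq_zero (insert q G) (A ∪ K) (by grind) (by grind)
    ⟨x, by grind⟩
  rw [e1] at h2
  rw [e2] at h3
  rw [e3] at h4
  rw [smul_mul_assoc]
  convert smul_zero _
  linear_combination h1 - h2 - h3 + h4

/-- Pair the terms of `xi_B` along some `p ∈ A \ B`. Multiplied by `xi_A`, both `h_G` and `h_{insert
p G}` may be replaced by `h_{A ∪ G}`, and they cancel. -/
theorem xi_mul_xi {V A B : Finset α} (hA : A ⊆ V) (hB : B ⊆ V) (hAB : (A ∩ B).Nonempty)
    (hAB' : ¬ A ⊆ B) (hBA : ¬ B ⊆ A) : xi V A * xi V B = 0 := by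
  obtain ⟨p, hpA, hpB⟩ := Finset.not_subset.1 hAB'
  obtain ⟨x, hx⟩ := hAB
  rw [xi.eq_def V B, mobius_eq_sum_sub _ (hA hpA) hpB, Finset.mul_sum]
  refine Finset.sum_eq_zero fun G hG => ?_
  rw [Finset.mem_Icc] at hG
  have hGV : G ⊆ V := hG.2.trans (Finset.erase_subset _ _)
  have hBG := hG.1
  have hGA : ¬ G ⊆ A := fun h => hBA (hBG.trans h)
  have e : A ∪ insert p G = A ∪ G := by grind
  rw [mul_smul_comm, mul_sub, xi_mul_h hA hGV ⟨x, by grind⟩ hGA,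
    xi_mul_h (K := insert p G) hA (by grind) ⟨x, by grind⟩ (fun h => hGA (by grind)), e, sub_self, smul_zero]

/-- From `h_G ^ 2 = h_G * h_{G \ k}`, all but one factor of a power of `h_G` can be moved to a set
with one element less. The induction ends at two elements, where `h` vanishes. -/
theorem h_pow_eq_zero {V G : Finset α} (hG : G ⊆ V) (hG2 : 2 ≤ G.card) {m : ℕ}
    (hm : G.card ≤ m + 1) : h V G ^ m = 0 := by
  induction hc : G.card using Nat.strong_induction_on generalizing G m with
  | _ c ih =>
    subst hc
    rcases hG2.eq_or_lt with h2 | h3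
    · rw [h_eq_zero (Or.inr h2.ge), zero_pow (by omega)]
    · obtain ⟨k, hk⟩ : G.Nonempty := Finset.card_pos.1 (by omega)
      have hcard : (G.erase k).card = G.card - 1 := Finset.card_erase_of_mem hk
      obtain ⟨p, hp⟩ : (G.erase k).Nonempty := Finset.card_pos.1 (by omega)
      have h1 := h_mul_h_sub (V := V) (P := G.erase k) (by grind) (hG hk) hp
      rw [Finset.insert_erase hk] at h1
      have key : ∀ j, h V G ^ (j + 1) = h V G * h V (G.erase k) ^ j := by
        intro j
        induction j with
        | zero => simp
        | succ j ihj =>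
          rw [pow_succ, ihj]
          linear_combination - h V (G.erase k) ^ j * h1
      obtain ⟨m, rfl⟩ : ∃ j, m = j + 1 := ⟨m - 1, by omega⟩
      rw [key, ih (G.erase k).card (by omega) (by grind) (by omega) (by omega) rfl, mul_zero]

/-- In the presence of `xi_A`, the generator `h_G` may be replaced by that of `G` with `A` shrunk to
one point `a`. This removes `|A| - 1` elements from `G`. By disjointness the other members of `T`
remain inside, strictly since `a` is left over. -/
theorem prod_xi_mul_h_pow {V G : Finset α} (T : Finset (Finset α)) (hG : G ⊆ V)
    (hG2 : 2 ≤ G.card) (hT : ∀ A ∈ T, A.Nonempty ∧ A ⊂ G)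
    (hTd : ∀ A ∈ T, ∀ B ∈ T, A ≠ B → Disjoint A B) {m : ℕ}
    (hm : G.card ≤ m + ∑ A ∈ T, (A.card - 1) + 1) :
    (∏ A ∈ T, xi V A) * h V G ^ m = 0 := by
  induction T using Finset.induction_on generalizing G with
  | empty => rw [h_pow_eq_zero hG hG2 (by simpa using hm), mul_zero]
  | insert A T hAT ih =>
    obtain ⟨⟨a, ha⟩, hAG⟩ := hT A (Finset.mem_insert_self _ _)
    obtain ⟨hAG1, hAG2⟩ := Finset.ssubset_iff_subset_ne.1 hAG
    obtain ⟨b, hbG, hbA⟩ := Finset.exists_of_ssubset hAG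
    have hsub : A.erase a ⊆ G := (Finset.erase_subset _ _).trans hAG1
    have hcard : (G \ A.erase a).card = G.card - (A.card - 1) := by
      rw [Finset.card_sdiff_of_subset hsub, Finset.card_erase_of_mem ha]
    have hle := Finset.card_le_card hsub
    rw [Finset.card_erase_of_mem ha] at hle
    have haG : a ∈ G := hAG1 ha
    have e : A ∪ (G \ A.erase a) = G := by grind
    have h1 : xi V A * h V G = xi V A * h V (G \ A.erase a) := by
      rw [xi_mul_h (hAG1.trans hG) (Finset.sdiff_subset.trans hG) ⟨a, by grind⟩
        (fun h => hbA (h (by grind))), e]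
    have h2 : ∀ j, xi V A * h V G ^ j = xi V A * h V (G \ A.erase a) ^ j := by
      intro j
      induction j with
      | zero => rfl
      | succ j ihj =>
        rw [pow_succ, pow_succ]
        linear_combination h V G * ihj + h V (G \ A.erase a) ^ j * h1
    have hd : ∀ B ∈ T, Disjoint A B := fun B hB =>
      hTd A (Finset.mem_insert_self _ _) B (Finset.mem_insert_of_mem hB)
        fun h => hAT (h ▸ hB)
    rw [Finset.sum_insert hAT] at hm
    rw [Finset.prod_insert hAT, mul_right_comm, h2, mul_right_comm, mul_assoc,
      ih (Finset.sdiff_subset.trans hG) ?_ ?_ ?_ ?_, mul_zero]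
    · exact Finset.one_lt_card.2 ⟨a, by grind, b, by grind, fun h => hbA (h ▸ ha)⟩
    · intro B hB
      have hBA := hd B hB
      rw [Finset.disjoint_left] at hBA
      obtain ⟨hB1, hB2⟩ := hT B (Finset.mem_insert_of_mem hB)
      have hBG := hB2.subset
      refine ⟨hB1, Finset.ssubset_iff_subset_ne.2 ⟨by grind, fun h => hBA ha ?_⟩⟩
      rw [h]
      grind
    · exact fun B hB C hC => hTd B (Finset.mem_insert_of_mem hB) C (Finset.mem_insert_of_mem hC)
    · rw [hcard]
      omega

end BraidRing

end BoundaryClasses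

/-! ### The Chow relations in the braid ring. -/

section BraidChow

variable {n : ℕ}

open BraidRing

theorem eRk_biUnion_cliqueEdges_le (T : Finset (Finset (Fin n))) (hT : ∀ A ∈ T, A.Nonempty) :
    (braidMatroid n).eRk (⋃ A ∈ T, cliqueEdges A) ≤ (∑ A ∈ T, (A.card - 1) : ℕ) := by
  induction T using Finset.induction_on with
  | empty => simp
  | insert A T hAT ih =>
    rw [Finset.set_biUnion_insert, Finset.sum_insert hAT, Nat.cast_add]
    refine ((braidMatroid n).eRk_union_le_eRk_add_eRk _ _).trans (add_le_add ?_ (ih fun B hB =>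
      hT B (Finset.mem_insert_of_mem hB)))
    rw [eRk_cliqueEdges (hT A (Finset.mem_insert_self _ _))]

/-- The relations of the Chow ring hold for the elements `xi`. -/
theorem prod_xi_mul_h_pow_rank (S : Finset (Finset (Fin n))) (hS : ∀ A ∈ S, A.Nonempty)
    {G : Finset (Fin n)} (hG2 : 2 ≤ G.card) :
    (∏ A ∈ S, xi Finset.univ A) * h Finset.univ G ^ (G.card - 1 -
      ((braidMatroid n).eRk (⋃ A ∈ S.filter (· ⊂ G), cliqueEdges A)).toNat) = 0 := by
  classical
  -- A meeting incomparable pair kills the product. Otherwise the maximal members of `S` strictly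
  -- below `G` are disjoint, and they bound the rank of the join by the sum of `|A| - 1`.
  by_cases hc : ∃ A ∈ S, ∃ B ∈ S, (A ∩ B).Nonempty ∧ ¬ A ⊆ B ∧ ¬ B ⊆ A
  · obtain ⟨A, hA, B, hB, hAB, hAB1, hAB2⟩ := hc
    have hne : A ≠ B := fun h => hAB1 h.subset
    rw [← Finset.mul_prod_erase _ _ hA,
      ← Finset.mul_prod_erase _ _ (Finset.mem_erase.2 ⟨hne.symm, hB⟩), ← mul_assoc,
      xi_mul_xi (Finset.subset_univ _) (Finset.subset_univ _) hAB hAB1 hAB2, zero_mul, zero_mul]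
  · push Not at hc
    let T := (S.filter (· ⊂ G)).filter fun A => ∀ B ∈ S.filter (· ⊂ G), A ⊆ B → A = B
    have hTS : T ⊆ S := (Finset.filter_subset _ _).trans (Finset.filter_subset _ _)
    have hcover : ∀ A ∈ S.filter (· ⊂ G), ∃ B ∈ T, A ⊆ B := by
      intro A hA
      obtain ⟨B, hAB, hB⟩ := (S.filter (· ⊂ G)).exists_le_maximal hA
      exact ⟨B, Finset.mem_filter.2 ⟨hB.prop, fun C hC hBC => hB.eq_of_le hC hBC⟩, hAB⟩
    have hrank : ((braidMatroid n).eRk (⋃ A ∈ S.filter (· ⊂ G), cliqueEdges A)).toNat ≤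
        ∑ A ∈ T, (A.card - 1) := by
      refine ENat.toNat_le_of_le_coe (le_trans ((braidMatroid n).eRk_mono ?_)
        (eRk_biUnion_cliqueEdges_le T fun A hA => hS A (hTS hA)))
      refine Set.iUnion₂_subset fun A hA => ?_
      obtain ⟨B, hB, hAB⟩ := hcover A hA
      exact Set.subset_iUnion₂_of_subset B hB fun e he => ⟨he.1, fun x hx => hAB (he.2 x hx)⟩
    rw [← Finset.prod_sdiff hTS, mul_assoc, prod_xi_mul_h_pow T (Finset.subset_univ _) hG2 ?_ ?_ ?_,
      mul_zero]
    · exact fun A hA => ⟨hS A (hTS hA),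
        (Finset.mem_filter.1 (Finset.filter_subset _ _ hA)).2⟩
    · intro A hA B hB hAB
      by_contra hd
      have h1 := hc A (hTS hA) B (hTS hB)
        (by rwa [Finset.disjoint_iff_inter_eq_empty, ← Finset.not_nonempty_iff_eq_empty,
          not_not] at hd)
      by_cases h2 : A ⊆ B
      · exact hAB ((Finset.mem_filter.1 hA).2 B (Finset.filter_subset _ _ hB) h2)
      · exact hAB.symm ((Finset.mem_filter.1 hB).2 A (Finset.filter_subset _ _ hA) (h1 h2))
    · omega

end BraidChow

/-! ### The isomorphism between the Chow ring and the braid ring. -/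

section ChowIso

variable {n : ℕ}

open BraidRing

/-- The minimal building set of the braid matroid. -/
abbrev BraidBuilding (n : ℕ) : Type := minimalBuildingSet (braidMatroid n)

noncomputable instance : Fintype (BraidBuilding n) := Fintype.ofFinite _

/-- The vertex set of an element of the minimal building set. -/
noncomputable def verts (G : BraidBuilding n) : Finset (Fin n) :=
  (mem_minimalBuildingSet_iff.1 G.2).choose

theorem two_le_card_verts (G : BraidBuilding n) : 2 ≤ (verts G).card :=
  (mem_minimalBuildingSet_iff.1 G.2).choose_spec.1

theorem cliqueEdges_verts (G : BraidBuilding n) : cliqueEdges (verts G) = G.1 :=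
  (mem_minimalBuildingSet_iff.1 G.2).choose_spec.2.symm

/-- The element of the minimal building set with a given vertex set. -/
def clique (A : Finset (Fin n)) (hA : 2 ≤ A.card) : BraidBuilding n :=
  ⟨cliqueEdges A, mem_minimalBuildingSet_iff.2 ⟨A, hA, rfl⟩⟩

theorem verts_subset_verts_iff {G H : BraidBuilding n} : verts G ⊆ verts H ↔ G.1 ⊆ H.1 := by
  rw [← cliqueEdges_subset_iff (two_le_card_verts G), cliqueEdges_verts, cliqueEdges_verts]

theorem verts_ssubset_verts_iff {G H : BraidBuilding n} : verts G ⊂ verts H ↔ G.1 ⊂ H.1 := by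
  rw [ssubset_iff_subset_not_subset, ssubset_iff_subset_not_subset, verts_subset_verts_iff,
    verts_subset_verts_iff]

theorem verts_injective : Function.Injective (verts (n := n)) := fun G H hGH =>
  Subtype.ext (by rw [← cliqueEdges_verts, hGH, cliqueEdges_verts])

@[simp]
theorem verts_clique (A : Finset (Fin n)) (hA : 2 ≤ A.card) : verts (clique A hA) = A :=
  Finset.Subset.antisymm
    ((cliqueEdges_subset_iff (two_le_card_verts _)).1 (cliqueEdges_verts (clique A hA)).subset)
    ((cliqueEdges_subset_iff hA).1 (cliqueEdges_verts (clique A hA)).superset)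

@[simp]
theorem clique_verts (G : BraidBuilding n) : clique (verts G) (two_le_card_verts G) = G :=
  verts_injective (verts_clique _ _)

theorem toNat_eRk_coe (G : BraidBuilding n) :
    ((braidMatroid n).eRk G.1).toNat = (verts G).card - 1 := by
  rw [← cliqueEdges_verts, eRk_cliqueEdges (Finset.card_pos.1
    (lt_of_lt_of_le two_pos (two_le_card_verts G)))]
  rfl

theorem eRk_supBelow (S : Finset (BraidBuilding n)) (G : BraidBuilding n) :
    (braidMatroid n).eRk (supBelow (braidMatroid n) S G) =
      (braidMatroid n).eRk (⋃ A ∈ (S.image verts).filter (· ⊂ verts G), cliqueEdges A) := by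
  rw [supBelow, Matroid.eRk_closure_eq]
  congr 1
  ext e
  simp only [Set.mem_iUnion, Set.mem_setOf_eq, Finset.mem_filter, Finset.mem_image, exists_prop]
  constructor
  · rintro ⟨A, ⟨hA, hAG⟩, he⟩
    exact ⟨verts A, ⟨⟨A, hA, rfl⟩, verts_ssubset_verts_iff.2 hAG⟩, by rwa [cliqueEdges_verts]⟩
  · rintro ⟨_, ⟨⟨A, hA, rfl⟩, hAG⟩, he⟩
    exact ⟨A, ⟨hA, verts_ssubset_verts_iff.1 hAG⟩, by rwa [cliqueEdges_verts] at he⟩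

/-- The Chow ring of the braid matroid with respect to its minimal building set. -/
abbrev BraidChow (n : ℕ) : Type :=
  ChowRing (braidMatroid n) (minimalBuildingSet (braidMatroid n))

/-- The generators of the Chow ring. -/
noncomputable def chowX (G : BraidBuilding n) : BraidChow n :=
  Ideal.Quotient.mk _ (MvPolynomial.X G)

theorem chowX_relation (S : Finset (BraidBuilding n)) (G : BraidBuilding n) :
    (∏ A ∈ S, chowX A) * (∑ H with verts G ⊆ verts H, chowX H) ^
      ((verts G).card - 1 - ((braidMatroid n).eRk (supBelow (braidMatroid n) S G)).toNat) = 0 := by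
  have hmem : (∏ A ∈ S, MvPolynomial.X (R := ℚ) A) *
      (∑ H ∈ (Set.toFinite {H : BraidBuilding n | G.1 ⊆ H.1}).toFinset, MvPolynomial.X H) ^
        (((braidMatroid n).eRk G.1).toNat -
          ((braidMatroid n).eRk (supBelow (braidMatroid n) S G)).toNat) ∈
      chowIdeal (braidMatroid n) (minimalBuildingSet (braidMatroid n)) :=
    Ideal.subset_span ⟨S, G, rfl⟩
  have h := Ideal.Quotient.eq_zero_iff_mem.2 hmem
  rw [map_mul, map_prod, map_pow, map_sum, toNat_eRk_coe] at h
  have e : (Set.toFinite {H : BraidBuilding n | G.1 ⊆ H.1}).toFinset =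
      Finset.univ.filter fun H => verts G ⊆ verts H := by
    ext H
    simp [verts_subset_verts_iff]
  rw [e] at h
  exact h

theorem sum_verts {M : Type*} [AddCommMonoid M] (f : Finset (Fin n) → M) {A : Finset (Fin n)}
    (hA : 2 ≤ A.card) :
    ∑ H : BraidBuilding n with A ⊆ verts H, f (verts H) = ∑ K ∈ Finset.Icc A Finset.univ, f K := by
  refine Finset.sum_bij (fun H _ => verts H) ?_ (fun _ _ _ _ h => verts_injective h) ?_
    fun _ _ => rfl
  · intro H hH
    simpa using hH
  · intro K hK
    rw [Finset.mem_Icc] at hK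
    refine ⟨clique K (hA.trans (Finset.card_le_card hK.1)), ?_, verts_clique _ _⟩
    simpa using hK.1

theorem sum_verts_xi {A : Finset (Fin n)} (hA : 2 ≤ A.card) :
    ∑ H : BraidBuilding n with A ⊆ verts H, xi Finset.univ (verts H) = h Finset.univ A := by
  rw [sum_verts _ hA, sum_xi (Finset.subset_univ A)]

/-- The map from the Chow ring to the braid ring that sends the generators to the elements `xi`. -/
noncomputable def chowToBraid (n : ℕ) :
    BraidChow n →ₐ[ℚ] BraidRing (Finset.univ : Finset (Fin n)) :=
  Ideal.Quotient.liftₐ (chowIdeal (braidMatroid n) (minimalBuildingSet (braidMatroid n)))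
    (MvPolynomial.aeval fun G : BraidBuilding n => xi Finset.univ (verts G)) (by
      intro p hp
      have : chowIdeal (braidMatroid n) (minimalBuildingSet (braidMatroid n)) ≤
          RingHom.ker (MvPolynomial.aeval (R := ℚ)
            fun G : BraidBuilding n => xi Finset.univ (verts G)) := by
        rw [chowIdeal, Ideal.span_le]
        rintro p ⟨S, G, rfl⟩
        have e : (Set.toFinite {H : BraidBuilding n | G.1 ⊆ H.1}).toFinset =
            Finset.univ.filter fun H => verts G ⊆ verts H := by
          ext H
          simp [verts_subset_verts_iff]
        rw [SetLike.mem_coe, RingHom.mem_ker, e, map_mul, map_prod, map_pow, map_sum,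
          toNat_eRk_coe, eRk_supBelow]
        simp only [MvPolynomial.aeval_X]
        rw [sum_verts_xi (two_le_card_verts G), ← prod_xi_mul_h_pow_rank (S.image verts) _
          (two_le_card_verts G), Finset.prod_image verts_injective.injOn]
        intro A hA
        obtain ⟨B, -, rfl⟩ := Finset.mem_image.1 hA
        exact Finset.card_pos.1 (lt_of_lt_of_le two_pos (two_le_card_verts B))
      exact this hp)

@[simp]
theorem chowToBraid_mk (p : MvPolynomial (BraidBuilding n) ℚ) :
    chowToBraid n (Ideal.Quotient.mk _ p) =
      MvPolynomial.aeval (fun G : BraidBuilding n => xi Finset.univ (verts G)) p :=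
  rfl

theorem chowToBraid_chowX (G : BraidBuilding n) :
    chowToBraid n (chowX G) = xi Finset.univ (verts G) := by
  rw [chowX, chowToBraid_mk, MvPolynomial.aeval_X]

/-- The sum of the generators of the Chow ring that contain a set of vertices. -/
noncomputable def chowH (A : Finset (Fin n)) : BraidChow n :=
  -- The cutoff matters: for smaller `A` the sum is not a relation of the Chow ring, while the braid
  -- relations require zero.
  if 2 ≤ A.card then ∑ H with A ⊆ verts H, chowX H else 0

/-- For two vertices this is the Chow relation with `S = ∅`, where the exponent is the rank `1`. -/
theorem chowH_eq_zero {A : Finset (Fin n)} (hA : A.card ≤ 2) : chowH A = 0 := by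
  rw [chowH]
  split_ifs with h2
  · have h := chowX_relation ∅ (clique A h2)
    have h0 : (braidMatroid n).eRk (supBelow (braidMatroid n) ∅ (clique A h2)) = 0 := by
      rw [eRk_supBelow]
      simp
    rw [h0, verts_clique, le_antisymm hA h2] at h
    simpa using h
  · rfl

/-- Take `S = {H, K}` and for `G` the clique on the union of their vertices. The join already has
full rank, so the exponent is zero and the relation is a plain monomial. -/
theorem chowX_mul_chowX {H K : BraidBuilding n} (hHK : (verts H ∩ verts K).Nonempty)
    (h1 : ¬ verts H ⊆ verts K) (h2 : ¬ verts K ⊆ verts H) : chowX H * chowX K = 0 := by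
  classical
  have hU : 2 ≤ (verts H ∪ verts K).card :=
    (two_le_card_verts H).trans (Finset.card_le_card Finset.subset_union_left)
  have h := chowX_relation {H, K} (clique _ hU)
  have hne : H ≠ K := fun e => h1 (e ▸ subset_rfl)
  have hle : (verts H ∪ verts K).card - 1 ≤
      ((braidMatroid n).eRk (supBelow (braidMatroid n) {H, K} (clique _ hU))).toNat := by
    have e := toNat_eRk_coe (clique _ hU)
    rw [verts_clique] at e
    rw [← e]
    refine ENat.toNat_le_toNat ?_ ((braidMatroid n).isRkFinite_set _).eRk_lt_top.ne
    refine (braidMatroid n).eRk_mono ?_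
    refine (cliqueEdges_union_subset_closure hHK).trans ?_
    refine (braidMatroid n).closure_subset_closure ?_
    refine Set.union_subset ?_ ?_
    · rw [cliqueEdges_verts]
      refine Set.subset_biUnion_of_mem (u := fun A : BraidBuilding n => A.1) ?_
      refine ⟨by simp, verts_ssubset_verts_iff.1 ?_⟩
      rw [verts_clique]
      exact Finset.ssubset_iff_subset_ne.2 ⟨Finset.subset_union_left, by grind⟩
    · rw [cliqueEdges_verts]
      refine Set.subset_biUnion_of_mem (u := fun A : BraidBuilding n => A.1) ?_
      refine ⟨by simp, verts_ssubset_verts_iff.1 ?_⟩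
      rw [verts_clique]
      exact Finset.ssubset_iff_subset_ne.2 ⟨Finset.subset_union_right, by grind⟩
  rw [verts_clique, Nat.sub_eq_zero_of_le hle, pow_zero, mul_one, Finset.prod_pair hne] at h
  exact h

theorem chowH_sub_chowH_union {A B : Finset (Fin n)} (hA : 2 ≤ A.card) :
    chowH A - chowH (A ∪ B) = ∑ H with A ⊆ verts H ∧ ¬ B ⊆ verts H, chowX H := by
  rw [chowH, chowH, if_pos hA,
    if_pos (hA.trans (Finset.card_le_card Finset.subset_union_left)), sub_eq_iff_eq_add,
    ← Finset.sum_filter_add_sum_filter_not _ (fun H => ¬ B ⊆ verts H), Finset.filter_filter,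
    Finset.filter_filter]
  congr 2
  ext H
  simp [Finset.union_subset_iff]

/-- For incomparable `A` and `B` the two factors are sums of `x_H` with `A ⊆ H`, `B ⊄ H` and of
`x_K` with `B ⊆ K`, `A ⊄ K`. Such `H` and `K` meet and are incomparable, so every product vanishes.
-/
theorem isBraidFamily_chowH : IsBraidFamily Finset.univ (chowH (n := n)) where
  eq_zero A hA := chowH_eq_zero (hA.resolve_left fun h => h (Finset.subset_univ A))
  mul_eq_zero A B _ _ hAB := by
    by_cases h1 : A ⊆ B
    · rw [Finset.union_eq_right.2 h1, sub_self, mul_zero]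
    by_cases h2 : B ⊆ A
    · rw [Finset.union_eq_left.2 h2, sub_self, zero_mul]
    obtain ⟨x, hx⟩ := hAB
    obtain ⟨a, ha, ha'⟩ := Finset.not_subset.1 h1
    obtain ⟨b, hb, hb'⟩ := Finset.not_subset.1 h2
    have hA : 2 ≤ A.card := Finset.one_lt_card.2 ⟨x, by grind, a, ha, by grind⟩
    have hB : 2 ≤ B.card := Finset.one_lt_card.2 ⟨x, by grind, b, hb, by grind⟩
    rw [chowH_sub_chowH_union hA, Finset.union_comm, chowH_sub_chowH_union hB,
      Finset.sum_mul_sum]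
    refine Finset.sum_eq_zero fun H hH => Finset.sum_eq_zero fun K hK => ?_
    simp only [Finset.mem_filter, Finset.mem_univ, true_and] at hH hK
    exact chowX_mul_chowX ⟨x, by grind⟩ (fun h => hK.2 (hH.1.trans h))
      fun h => hH.2 (hK.1.trans h)

/-- The Chow ring of the braid matroid is isomorphic to the braid ring. -/
noncomputable def chowEquivBraid (n : ℕ) :
    BraidChow n ≃ₐ[ℚ] BraidRing (Finset.univ : Finset (Fin n)) :=
  AlgEquiv.ofAlgHom (chowToBraid n) (lift isBraidFamily_chowH)
    (by
      refine BraidRing.algHom_ext fun A _ hA => ?_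
      rw [AlgHom.comp_apply, lift_h, chowH, if_pos hA.le, map_sum, AlgHom.id_apply]
      simp only [chowToBraid_chowX]
      exact sum_verts_xi hA.le)
    (by
      refine Ideal.Quotient.algHom_ext _ (MvPolynomial.algHom_ext fun G => ?_)
      change lift isBraidFamily_chowH (chowToBraid n (chowX G)) = chowX G
      -- The Möbius transform of `chowH` gives back the generators. They are extended by zero to
      -- small sets, which do not contain the vertex set of `G`.
      rw [chowToBraid_chowX, xi, map_mobius]
      have hG := two_le_card_verts G
      refine (mobius_congr (g := fun K => ∑ L ∈ Finset.Icc K Finset.univ,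
        if hL : 2 ≤ L.card then chowX (clique L hL) else 0) fun K hK _ => ?_).trans
        ((mobius_sum _ (Finset.subset_univ _)).trans ?_)
      · have hK2 := hG.trans (Finset.card_le_card hK)
        rw [lift_h, chowH, if_pos hK2, ← sum_verts _ hK2]
        refine Finset.sum_congr rfl fun H _ => ?_
        rw [dif_pos (two_le_card_verts H), clique_verts]
      · rw [dif_pos hG, clique_verts])

end ChowIso

/-! ### Dimensions from eigenvectors, and the Hilbert series. -/

section EigenBasis

variable {E ι : Type*} [AddCommGroup E] [Module ℚ E]

/-- Comparing coordinates of `T x` in two ways, a nonzero coordinate forces equal eigenvalues, and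
the powers of `2` are distinct. -/
theorem repr_eq_zero_of_mem {P : ℕ → Submodule ℚ E} {T : E →ₗ[ℚ] E}
    (hT : ∀ i, ∀ x ∈ P i, T x = (2 : ℚ) ^ i • x) {b : Module.Basis ι ℚ E} {d : ι → ℕ}
    (hb : ∀ j, T (b j) = (2 : ℚ) ^ d j • b j) {k : ℕ} {x : E} (hx : x ∈ P k) {j : ι}
    (hj : d j ≠ k) : b.repr x j = 0 := by
  have h1 : b.repr (T x) j = (2 : ℚ) ^ d j * b.repr x j := by
    have : (b.coord j) ∘ₗ T = (2 : ℚ) ^ d j • b.coord j := by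
      refine b.ext fun l => ?_
      simp only [LinearMap.comp_apply, hb, map_smul, LinearMap.smul_apply, smul_eq_mul,
        Module.Basis.coord_apply, Module.Basis.repr_self]
      by_cases h : l = j
      · rw [h]
      · rw [Finsupp.single_eq_of_ne (Ne.symm h), mul_zero, mul_zero]
    simpa using LinearMap.congr_fun this x
  rw [hT k x hx, map_smul, Finsupp.smul_apply, smul_eq_mul] at h1
  have h2 : ((2 : ℚ) ^ k - 2 ^ d j) * b.repr x j = 0 := by rw [sub_mul, h1, sub_self]
  refine (mul_eq_zero.1 h2).resolve_left fun h => hj ?_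
  exact (pow_right_injective₀ (two_pos) (by norm_num) (sub_eq_zero.1 h)).symm

/-- If a spanning family of subspaces consists of eigenspaces for the eigenvalues `2 ^ i`, then the
dimensions of the subspaces can be read off from any basis of eigenvectors. -/
theorem finrank_eq_card_of_eigenbasis [Fintype ι] {P : ℕ → Submodule ℚ E} (hP : ⨆ i, P i = ⊤)
    {T : E →ₗ[ℚ] E} (hT : ∀ i, ∀ x ∈ P i, T x = (2 : ℚ) ^ i • x) {b : Module.Basis ι ℚ E}
    {d : ι → ℕ} (hb : ∀ j, T (b j) = (2 : ℚ) ^ d j • b j) (k : ℕ) :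
    Module.finrank ℚ (P k) = Fintype.card {j // d j = k} := by
  -- The projection to the basis vectors of degree `k` fixes `P k` and kills the other pieces. As
  -- the pieces span, its image lies in `P k`.
  have hproj : ∀ x, ∑ j with d j = k, b.repr x j • b j ∈ P k := by
    intro x
    have hx : x ∈ ⨆ i, P i := hP ▸ Submodule.mem_top
    induction hx using Submodule.iSup_induction' with
    | mem l x hx =>
      by_cases hl : l = k
      · subst hl
        have : ∑ j with d j = l, b.repr x j • b j = x := by
          rw [Finset.sum_filter_of_ne, b.sum_repr]
          intro j _ h
          by_contra hj
          rw [repr_eq_zero_of_mem hT hb hx hj, zero_smul] at h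
          exact h rfl
        rwa [this]
      · rw [Finset.sum_eq_zero]
        · exact zero_mem _
        · intro j hj
          rw [repr_eq_zero_of_mem hT hb hx (by rw [(Finset.mem_filter.1 hj).2]; exact Ne.symm hl),
            zero_smul]
    | zero => simp
    | add x y _ _ hx hy =>
      simp only [map_add, Finsupp.add_apply, add_smul, Finset.sum_add_distrib]
      exact add_mem hx hy
  have hspan : P k = Submodule.span ℚ (Set.range fun j : {j // d j = k} => b j) := by
    refine le_antisymm (fun x hx => ?_) ?_
    · rw [← b.sum_repr x]
      refine Submodule.sum_mem _ fun j _ => ?_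
      by_cases hj : d j = k
      · exact Submodule.smul_mem _ _ (Submodule.subset_span ⟨⟨j, hj⟩, rfl⟩)
      · rw [repr_eq_zero_of_mem hT hb hx hj, zero_smul]
        exact zero_mem _
    · rw [Submodule.span_le]
      rintro _ ⟨⟨j, hj⟩, rfl⟩
      have := hproj (b j)
      rw [Finset.sum_eq_single_of_mem j (by simp [hj])] at this
      · simpa using this
      · intro l _ hl
        rw [b.repr_self, Finsupp.single_eq_of_ne hl, zero_smul]
  rw [hspan]
  exact finrank_span_eq_card (b.linearIndependent.comp _ Subtype.val_injective)

end EigenBasis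

theorem iSup_chowPiece {α : Type*} [Finite α] (M : Matroid α) (𝒢 : Set (Set α)) :
    ⨆ i, chowPiece M 𝒢 i = ⊤ := by
  refine eq_top_iff.2 fun x _ => ?_
  obtain ⟨p, rfl⟩ := Ideal.Quotient.mkₐ_surjective ℚ (chowIdeal M 𝒢) x
  rw [← MvPolynomial.sum_homogeneousComponent p, map_sum]
  refine Submodule.sum_mem _ fun i _ => Submodule.mem_iSup_of_mem i ?_
  exact ⟨_, MvPolynomial.homogeneousComponent_mem i p, rfl⟩

theorem MvPolynomial.IsHomogeneous.aeval_two_mul {σ A : Type*} [CommRing A] [Algebra ℚ A]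
    {p : MvPolynomial σ ℚ} {i : ℕ} (hp : p.IsHomogeneous i) (f : σ → A) :
    MvPolynomial.aeval (fun s => 2 * f s) p = (2 : ℚ) ^ i • MvPolynomial.aeval f p := by
  rw [p.as_sum, map_sum, map_sum, Finset.smul_sum]
  refine Finset.sum_congr rfl fun m hm => ?_
  have hdeg : ∑ s ∈ m.support, m s = i := by
    simpa [Finsupp.weight_apply, Finsupp.sum] using hp (MvPolynomial.mem_support_iff.1 hm)
  rw [MvPolynomial.aeval_monomial, MvPolynomial.aeval_monomial, ← mul_smul_comm]
  congr 1
  simp only [mul_pow, Finsupp.prod_mul]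
  rw [Finsupp.prod, Finset.prod_pow_eq_pow_sum, hdeg, Algebra.smul_def, map_pow,
    map_ofNat]

theorem braidHilbertSeries_eq {n : ℕ} (hn : 1 ≤ n) :
    braidHilbertSeries n = (maninPoly n : PowerSeries ℚ) := by
  obtain ⟨ι, _, b, d, hb, hp⟩ := hasHilbertPoly_maninPoly (Finset.univ : Finset (Fin n)) (by simpa)
  rw [Finset.card_univ, Fintype.card_fin] at hp
  ext i
  rw [braidHilbertSeries, chowHilbertSeries, PowerSeries.coeff_mk, Polynomial.coeff_coe, hp]
  let e := (chowEquivBraid n).toLinearEquiv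
  have key := finrank_eq_card_of_eigenbasis
    (P := chowPiece (braidMatroid n) (minimalBuildingSet (braidMatroid n)))
    (iSup_chowPiece _ _)
    -- `scale` is transported to the Chow ring. It doubles each `xi`, the image of a generator,
    -- hence is `2 ^ k` on the piece of degree `k`.
    (T := e.symm.toLinearMap ∘ₗ (BraidRing.scale Finset.univ).toLinearMap ∘ₗ e.toLinearMap)
    (by
      rintro k _ ⟨p, hp, rfl⟩
      have h1 : e ((Ideal.Quotient.mkₐ ℚ _).toLinearMap p) = MvPolynomial.aeval
          (fun G : BraidBuilding n => BraidRing.xi Finset.univ (verts G)) p := rfl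
      simp only [LinearMap.comp_apply, LinearEquiv.coe_coe, AlgHom.toLinearMap_apply] at h1 ⊢
      rw [LinearEquiv.symm_apply_eq, map_smul, h1,
        ← MvPolynomial.IsHomogeneous.aeval_two_mul ((MvPolynomial.mem_homogeneousSubmodule _ _).1 hp),
        ← AlgHom.comp_apply, MvPolynomial.comp_aeval]
      simp only [BraidRing.scale_xi])
    (b := b.map e.symm) (d := d)
    (by
      intro j
      simp [hb])
    i
  rw [key, Fintype.card_subtype, Polynomial.finsetSum_coeff]
  simp only [Polynomial.coeff_X_pow]
  rw [Finset.sum_boole]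
  simp only [eq_comm]

/-! ### The two recursions and uniqueness. -/

theorem manin_recursion {n : ℕ} (hn : 3 ≤ n) :
    braidHilbertSeries n = braidHilbertSeries (n - 1) +
      PowerSeries.X * ∑ j ∈ Finset.Icc 2 (n - 1),
        ((n - 1).choose j : PowerSeries ℚ) *
          (braidHilbertSeries j * braidHilbertSeries (n - j)) := by
  rw [braidHilbertSeries_eq (by lia), braidHilbertSeries_eq (by lia), maninPoly_eq (by lia)]
  simp only [Polynomial.coe_add, Polynomial.coe_mul, Polynomial.coe_X]
  congr 2
  rw [← Polynomial.coeToPowerSeries.ringHom_apply, map_sum]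
  refine Finset.sum_congr rfl fun j hj => ?_
  rw [Finset.mem_Icc] at hj
  rw [braidHilbertSeries_eq (by lia), braidHilbertSeries_eq (by lia), map_mul, map_mul,
    map_natCast]
  rfl

/-- Symmetrization of the sum in the first recursion yields the sum in the second one. -/
theorem two_mul_sum_choose_pred {R : Type*} [CommRing R] (a : ℕ → R) {n : ℕ} (hn : 3 ≤ n) :
    2 * ∑ j ∈ Finset.Icc 2 (n - 2), ((n - 1).choose j : R) * (a j * a (n - j)) =
      ∑ j ∈ Finset.Icc 2 (n - 2), (n.choose j : R) * (a j * a (n - j)) := by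
  -- Reflecting `j ↦ n - j` turns the coefficient into `(n - 1).choose (j - 1)`; Pascal's rule then
  -- adds the two forms of the sum.
  have hrefl : ∑ j ∈ Finset.Icc 2 (n - 2), ((n - 1).choose j : R) * (a j * a (n - j)) =
      ∑ j ∈ Finset.Icc 2 (n - 2), ((n - 1).choose (j - 1) : R) * (a j * a (n - j)) := by
    refine Finset.sum_bij' (fun j _ => n - j) (fun j _ => n - j) ?_ ?_ ?_ ?_ ?_
    · intro j hj
      rw [Finset.mem_Icc] at hj ⊢
      lia
    · intro j hj
      rw [Finset.mem_Icc] at hj ⊢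
      lia
    · intro j hj
      rw [Finset.mem_Icc] at hj
      lia
    · intro j hj
      rw [Finset.mem_Icc] at hj
      lia
    · intro j hj
      rw [Finset.mem_Icc] at hj
      rw [show n - (n - j) = j by lia, mul_comm (a j), ← Nat.choose_symm (show j ≤ n - 1 by lia),
        show n - 1 - j = n - j - 1 by lia]
  rw [two_mul]
  nth_rewrite 1 [hrefl]
  rw [← Finset.sum_add_distrib]
  refine Finset.sum_congr rfl fun j hj => ?_
  rw [Finset.mem_Icc] at hj
  obtain ⟨m, rfl⟩ : ∃ m, n = m + 1 := ⟨n - 1, by lia⟩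
  obtain ⟨k, rfl⟩ : ∃ k, j = k + 1 := ⟨j - 1, by lia⟩
  rw [Nat.choose_succ_succ]
  push_cast
  ring

theorem braidHilbertSeries_one : braidHilbertSeries 1 = 1 := by
  rw [braidHilbertSeries_eq le_rfl, maninPoly, Polynomial.coe_one]

theorem braidHilbertSeries_two : braidHilbertSeries 2 = 1 := by
  rw [braidHilbertSeries_eq one_le_two, maninPoly_eq le_rfl, maninPoly]
  simp

/-- The top term `j = n - 1` of Manin's sum contributes the additional `x H_{n-1}`, because `H_1 =
1`. The rest of the sum is symmetrized. -/
theorem keel_recursion {n : ℕ} (hn : 3 ≤ n) :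
    braidHilbertSeries n = (1 + PowerSeries.X) * braidHilbertSeries (n - 1) +
      PowerSeries.C (1 / 2 : ℚ) * PowerSeries.X * ∑ j ∈ Finset.Icc 2 (n - 2),
        (n.choose j : PowerSeries ℚ) *
          (braidHilbertSeries j * braidHilbertSeries (n - j)) := by
  have h2 : PowerSeries.C (1 / 2 : ℚ) * 2 = 1 := by
    rw [← map_ofNat PowerSeries.C, ← map_mul]
    norm_num
  rw [manin_recursion hn, ← two_mul_sum_choose_pred _ hn, show n - 1 = n - 2 + 1 by lia,
    Finset.sum_Icc_succ_top (by lia), Nat.choose_self, show n - (n - 2 + 1) = 1 by lia,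
    braidHilbertSeries_one, Nat.cast_one]
  linear_combination -(PowerSeries.X * ∑ j ∈ Finset.Icc 2 (n - 2),
    ((n - 2 + 1).choose j : PowerSeries ℚ) *
      (braidHilbertSeries j * braidHilbertSeries (n - j))) * h2

/-- A sequence is determined by its first two terms and a recursion that expresses each later term
through the earlier ones. -/
theorem eq_of_recursion {R : Type*} {P Q : ℕ → R} {F : ℕ → (ℕ → R) → R} (h1 : P 1 = Q 1)
    (h2 : P 2 = Q 2)
    (hF : ∀ n, 3 ≤ n → (∀ m, 1 ≤ m → m < n → P m = Q m) → F n P = F n Q)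
    (hP : ∀ n, 3 ≤ n → P n = F n P) (hQ : ∀ n, 3 ≤ n → Q n = F n Q) :
    ∀ n, 1 ≤ n → P n = Q n := by
  intro n
  induction n using Nat.strong_induction_on with
  | _ n ih =>
    intro hn
    obtain rfl | rfl | h3 : n = 1 ∨ n = 2 ∨ 3 ≤ n := by lia
    · exact h1
    · exact h2
    · rw [hP n h3, hQ n h3]
      exact hF n h3 fun m hm hmn => ih m hmn hm

theorem proposition4p6 :
    -- `H_{K_n}` is a polynomial
    (∀ n : ℕ, 1 ≤ n → ∃ p : Polynomial ℚ, braidHilbertSeries n = (p : PowerSeries ℚ)) ∧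
    -- initial values
    braidHilbertSeries 1 = 1 ∧ braidHilbertSeries 2 = 1 ∧
    -- the first (Manin) recursion holds
    (∀ n : ℕ, 3 ≤ n →
      braidHilbertSeries n = braidHilbertSeries (n - 1) +
        PowerSeries.X * ∑ j ∈ Finset.Icc 2 (n - 1),
          ((n - 1).choose j : PowerSeries ℚ) *
            (braidHilbertSeries j * braidHilbertSeries (n - j))) ∧
    -- the second (Keel) recursion holds
    (∀ n : ℕ, 3 ≤ n →
      braidHilbertSeries n = (1 + PowerSeries.X) * braidHilbertSeries (n - 1) +
        PowerSeries.C (1 / 2 : ℚ) * PowerSeries.X * ∑ j ∈ Finset.Icc 2 (n - 2),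
          (n.choose j : PowerSeries ℚ) *
            (braidHilbertSeries j * braidHilbertSeries (n - j))) ∧
    -- the first recursion and the initial values determine the sequence
    (∀ P : ℕ → PowerSeries ℚ, P 1 = 1 → P 2 = 1 →
      (∀ n : ℕ, 3 ≤ n →
        P n = P (n - 1) + PowerSeries.X * ∑ j ∈ Finset.Icc 2 (n - 1),
          ((n - 1).choose j : PowerSeries ℚ) * (P j * P (n - j))) →
      ∀ n : ℕ, 1 ≤ n → P n = braidHilbertSeries n) ∧
    -- the second recursion and the initial values determine the sequence
    (∀ P : ℕ → PowerSeries ℚ, P 1 = 1 → P 2 = 1 →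
      (∀ n : ℕ, 3 ≤ n →
        P n = (1 + PowerSeries.X) * P (n - 1) +
          PowerSeries.C (1 / 2 : ℚ) * PowerSeries.X * ∑ j ∈ Finset.Icc 2 (n - 2),
            (n.choose j : PowerSeries ℚ) * (P j * P (n - j))) →
      ∀ n : ℕ, 1 ≤ n → P n = braidHilbertSeries n) := by
  refine ⟨fun n hn => ⟨maninPoly n, braidHilbertSeries_eq hn⟩, braidHilbertSeries_one,
    braidHilbertSeries_two, fun _ => manin_recursion, fun _ => keel_recursion, ?_, ?_⟩
  · intro P h1 h2 hP
    refine eq_of_recursion (F := fun n P => P (n - 1) + PowerSeries.X *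
      ∑ j ∈ Finset.Icc 2 (n - 1), ((n - 1).choose j : PowerSeries ℚ) * (P j * P (n - j)))
      (h1.trans braidHilbertSeries_one.symm) (h2.trans braidHilbertSeries_two.symm) ?_ hP
      fun _ => manin_recursion
    intro n hn ih
    rw [ih (n - 1) (by lia) (by lia)]
    congr 2
    refine Finset.sum_congr rfl fun j hj => ?_
    rw [Finset.mem_Icc] at hj
    rw [ih j (by lia) (by lia), ih (n - j) (by lia) (by lia)]
  · intro P h1 h2 hP
    refine eq_of_recursion (F := fun n P => (1 + PowerSeries.X) * P (n - 1) +
      PowerSeries.C (1 / 2 : ℚ) * PowerSeries.X *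
        ∑ j ∈ Finset.Icc 2 (n - 2), (n.choose j : PowerSeries ℚ) * (P j * P (n - j)))
      (h1.trans braidHilbertSeries_one.symm) (h2.trans braidHilbertSeries_two.symm) ?_ hP
      fun _ => keel_recursion
    intro n hn ih
    rw [ih (n - 1) (by lia) (by lia)]
    congr 2
    refine Finset.sum_congr rfl fun j hj => ?_
    rw [Finset.mem_Icc] at hj
    rw [ih j (by lia) (by lia), ih (n - j) (by lia) (by lia)]
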